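/- Let $\Gamma$ be a surface group, i.e. a group isomorphic to the fundamental group $\langle a_1,b_1,\dots,a_g,b_g \mid [a_1,b_1]\cdots[a_g,b_g]=1\rangle$ of a closed oriented surface of genus $g\ge 2$. Let $V=\mathbb{R}^3$ with canonical basis $(e_1,e_2,e_3)$, let $L_0\subset P(V)$ be the projective line of the plane spanned by $e_1$ and $e_3$, and let $A_{can}=P(V)\setminus(L_0\cup\{[e_2]\})$, with the topology induced by $P(V)$. The group $\mathrm{GL}_2=\mathrm{GL}(2,\mathbb{R})$ acts linearly on $V$ by $$\begin{pmatrix} a&b\\c&d\end{pmatrix}\longmapsto\begin{pmatrix} a&0&b\\0&1&0\\c&0&d\end{pmatrix},$$ and hence projectively on $A_{can}$. Let $\lambda_1,\lambda_2:\Gamma\to\mathrm{GL}_2$ be two injective homomorphisms with discrete image. Then the following are equivalent: (i) the two actions of $\Gamma$ on $A_{can}$ through $\lambda_1$ and $\lambda_2$ are topologically conjugate, i.e. there is a homeomorphism $f:A_{can}\to A_{can}$ with $f(\lambda_1(\gamma)\,p)=\lambda_2(\gamma)\,f(p)$ for all $\gamma\in\Gamma$ and $p\in A_{can}$; (ii)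 $\lambda_1$ and $\lambda_2$ are conjugate in $\mathrm{GL}_2$, i.e. there is $h\in\mathrm{GL}_2$ with $\lambda_2(\gamma)=h\,\lambda_1(\gamma)\,h^{-1}$ for all $\gamma\in\Gamma$. -/

import Mathlib

open scoped LinearAlgebra.Projectivization MatrixGroups

namespace SurfaceRigidity

/-- The word `[a₁, b₁] ⋯ [a_g, b_g]` in the free group on `a₁, …, a_g, b₁, …, b_g`. -/
def surfaceRelator (g : ℕ) : FreeGroup (Fin g ⊕ Fin g) :=
  (List.ofFn fun i : Fin g =>
    FreeGroup.of (Sum.inl i) * FreeGroup.of (Sum.inr i) *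
      (FreeGroup.of (Sum.inl i))⁻¹ * (FreeGroup.of (Sum.inr i))⁻¹).prod

/-- `⟨a₁, b₁, …, a_g, b_g | [a₁, b₁] ⋯ [a_g, b_g] = 1⟩`, the fundamental group of the closed
oriented surface of genus `g`. -/
abbrev GenusGroup (g : ℕ) : Type :=
  PresentedGroup ({surfaceRelator g} : Set (FreeGroup (Fin g ⊕ Fin g)))

/-- A surface group: a group isomorphic to the fundamental group of a closed oriented surface
of genus at least two (equivalently, of negative Euler characteristic `2 - 2 g`). -/
def IsSurfaceGroup (Γ : Type*) [Group Γ] : Prop :=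
  ∃ g : ℕ, 2 ≤ g ∧ Nonempty (Γ ≃* GenusGroup g)

/-- A discrete and faithful representation into `GL₂(ℝ)`. -/
def IsDiscreteFaithful {Γ : Type*} [Group Γ] (l : Γ →* GL (Fin 2) ℝ) : Prop :=
  Function.Injective l ∧ DiscreteTopology l.range

/-- The vector space `V = ℝ³`; its canonical basis `(e₁, e₂, e₃)` is indexed by `0, 1, 2`. -/
abbrev V : Type := Fin 3 → ℝ

/-- The usual topology of `P(V)`: the quotient topology from `V ∖ {0}`. -/
noncomputable instance projTopology : TopologicalSpace (ℙ ℝ V) :=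
  TopologicalSpace.coinduced (Projectivization.mk' ℝ : {v : V // v ≠ 0} → ℙ ℝ V) inferInstance

/-- The point `[e₂]` of `P(V)`. -/
noncomputable def ptE2 : ℙ ℝ V :=
  Projectivization.mk ℝ (Pi.single 1 1 : V) (by simp)

/-- The projective line `L₀ = [ker e₂*]`. -/
def lineL0 : Set (ℙ ℝ V) :=
  {p | p.submodule ≤ LinearMap.ker (LinearMap.proj 1 : V →ₗ[ℝ] ℝ)}

/-- The annulus `A_can = P(V) ∖ (L₀ ∪ {[e₂]})`. -/
def annulus : Set (ℙ ℝ V) :=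
  (lineL0 ∪ {ptE2})ᶜ

/-- The `3 × 3` matrix of the linear map acting by `A` on `ℝ e₁ ⊕ ℝ e₃` and fixing `e₂`. -/
def blockMatrix (A : Matrix (Fin 2) (Fin 2) ℝ) : Matrix (Fin 3) (Fin 3) ℝ :=
  !![A 0 0, 0, A 0 1; 0, 1, 0; A 1 0, 0, A 1 1]

/-- `blockMatrix` is multiplicative. -/
def blockHom : Matrix (Fin 2) (Fin 2) ℝ →* Matrix (Fin 3) (Fin 3) ℝ where
  toFun := blockMatrix
  map_one' := by
    ext i j
    fin_cases i <;> fin_cases j <;> simp [blockMatrix]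
  map_mul' A B := by
    ext i j
    fin_cases i <;> fin_cases j <;>
      simp [blockMatrix, Matrix.mul_apply, Fin.sum_univ_succ]

/-- The embedding of `GL₂` in `GL(V)`; followed by `GL(V) → PGL(V)` it identifies `GL₂` with the
stabilizer of `[e₂]` and `L₀`. -/
def embGL : GL (Fin 2) ℝ →* GL (Fin 3) ℝ :=
  Units.map blockHom

theorem embGL_smul (g : GL (Fin 2) ℝ) (v : V) :
    embGL g • v = ![g 0 0 * v 0 + g 0 1 * v 2, v 1, g 1 0 * v 0 + g 1 1 * v 2] := by
  change Matrix.mulVec (blockMatrix (g : Matrix (Fin 2) (Fin 2) ℝ)) v = _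
  ext i
  fin_cases i <;> simp [blockMatrix, Matrix.mulVec, dotProduct, Fin.sum_univ_succ]

theorem mk_mem_lineL0 {v : V} (hv : v ≠ 0) : Projectivization.mk ℝ v hv ∈ lineL0 ↔ v 1 = 0 := by
  simp [lineL0, Projectivization.submodule_mk, Submodule.span_singleton_le_iff_mem]

theorem embGL_smul_mem_lineL0 (g : GL (Fin 2) ℝ) (p : ℙ ℝ V) :
    embGL g • p ∈ lineL0 ↔ p ∈ lineL0 := by
  induction p with
  | h v hv =>
    rw [Projectivization.smul_mk, mk_mem_lineL0, mk_mem_lineL0, embGL_smul]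
    simp

theorem embGL_smul_ptE2 (g : GL (Fin 2) ℝ) : embGL g • ptE2 = ptE2 := by
  have h : embGL g • (Pi.single 1 1 : V) = Pi.single 1 1 := by
    rw [embGL_smul]
    ext i
    fin_cases i <;> simp
  simp only [ptE2, Projectivization.smul_mk, h]

theorem embGL_smul_mem_annulus (g : GL (Fin 2) ℝ) {p : ℙ ℝ V} (hp : p ∈ annulus) :
    embGL g • p ∈ annulus := by
  intro h
  apply hp
  rcases h with h | h
  · exact Or.inl ((embGL_smul_mem_lineL0 g p).1 h)
  · right
    have h1 : embGL g • p = embGL g • ptE2 := by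
      rw [embGL_smul_ptE2]
      exact h
    exact MulAction.injective (embGL g) h1

/-- The projective action of `GL₂` on the annulus `A_can`. -/
noncomputable instance annulusAction : MulAction (GL (Fin 2) ℝ) annulus where
  smul g p := ⟨embGL g • (p : ℙ ℝ V), embGL_smul_mem_annulus g p.2⟩
  one_smul p := Subtype.ext (by
    change embGL 1 • (p : ℙ ℝ V) = p
    rw [map_one, one_smul])
  mul_smul g h p := Subtype.ext (by
    change embGL (g * h) • (p : ℙ ℝ V) = embGL g • (embGL h • (p : ℙ ℝ V))
    rw [map_mul, mul_smul])

/-- The actions of `Γ` on `A_can` through `l₁` and `l₂` are topologically conjugate. -/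
def ConjugateActions {Γ : Type*} [Group Γ] (l₁ l₂ : Γ →* GL (Fin 2) ℝ) : Prop :=
  ∃ f : annulus ≃ₜ annulus, ∀ (γ : Γ) (p : annulus), f (l₁ γ • p) = l₂ γ • f p

/-- The representations `l₁` and `l₂` are conjugate in `GL₂`. -/
def ConjugateReps {Γ : Type*} [Group Γ] (l₁ l₂ : Γ →* GL (Fin 2) ℝ) : Prop :=
  ∃ h : GL (Fin 2) ℝ, ∀ γ : Γ, l₂ γ = h * l₁ γ * h⁻¹

end SurfaceRigidity

/-! In the affine chart `(v₀ / v₁, v₂ / v₁)` the annulus is the punctured plane with the linear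
action of `GL₂`, so a matrix conjugating the representations is itself a conjugating homeomorphism.
Conversely, an equivariant homeomorphism `F` of the punctured plane is studied through one
hyperbolic element.

A surface group is not solvable, hence neither is its commutator subgroup, which `l₁` embeds in
`SL₂(ℝ)`; such a group contains a hyperbolic `x` (`exists_hyperbolic`). The dynamics on the
punctured plane force `l₂ x` to be hyperbolic too (`PlaneConj.four_le_trace_sq`,
`PlaneConj.trace_sq_ne_four`), so both images may be taken diagonal, with expanding eigenvalues `μ`
and `ν`.

Then `F` maps the expanding axis to the expanding axis. On this axis `xⁿ y x⁻ⁿ` converges to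
multiplication by the upper left entry of `y`, so the induced map `ψ` satisfies `ψ (a t) = a' ψ t`
for the upper left entries `a ≠ 0`, `a'` of `l₁ y`, `l₂ y` (`PlaneConj.map_axis_mul`). The entries
of `y xⁿ z` provide multipliers `1 + c μ⁻²ⁿ` of `ψ` accumulating at `1`; by density and continuity
`ψ` is a power function on the positive reals, and its derivative at `1` forces the exponent to be
one (`rpow_exponent_eq_one`). So the nonzero upper left entries of `l₁` agree with those of `l₂`.
Applied to the products `y xⁿ z`, this determines the remaining entries up to a diagonal conjugation
(`IsDiagonalPair.conjugateReps`). -/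

open scoped commutatorElement
open Filter Topology

namespace SurfaceRigidity

/-! ### Non-solvability of surface groups -/

/-- A group whose commutators commute with each other is solvable. -/
theorem isSolvable_of_commutators_commute {G : Type*} [Group G]
    (h : ∀ x y z w : G, Commute ⁅x, y⁆ ⁅z, w⁆) : Group.IsSolvable G := by
  refine ⟨⟨2, ?_⟩⟩
  rw [derivedSeries_succ, derivedSeries_succ, derivedSeries_zero,
    Subgroup.commutator_eq_bot_iff_le_centralizer, Subgroup.commutator_le]
  intro x _ y _
  rw [Subgroup.mem_centralizer_iff]
  intro k hk
  have : k ∈ Subgroup.centralizer {⁅x, y⁆} := by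
    refine (Subgroup.commutator_le.2 ?_) hk
    intro z _ w _
    rw [Subgroup.mem_centralizer_singleton_iff]
    exact h z w x y
  rw [Subgroup.mem_centralizer_singleton_iff] at this
  exact this

theorem isSolvable_of_isSolvable_commutator {G : Type*} [Group G]
    (h : Group.IsSolvable (commutator G)) : Group.IsSolvable G := by
  refine Group.isSolvable_of_ker_le_range (commutator G).subtype (Abelianization.of (G := G)) ?_
  rw [Abelianization.ker_of, Subgroup.range_subtype]

/-- The surface group of genus `g ≥ 2` maps onto the symmetric group on five letters. -/
theorem not_isSolvable_genusGroup {g : ℕ} (hg : 2 ≤ g) : ¬ Group.IsSolvable (GenusGroup g) := by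
  intro hs
  -- All `bᵢ` go to `1`, which kills every commutator in the relator; `g ≥ 2` leaves room for a
  -- 5-cycle and a transposition among the `aᵢ`.
  let φ : Fin g ⊕ Fin g → Equiv.Perm (Fin 5) := Sum.elim
    (fun i => if i = ⟨0, by omega⟩ then finRotate 5 else
      if i = ⟨1, by omega⟩ then Equiv.swap 0 1 else 1) (fun _ => 1)
  have hr : ∀ r ∈ ({surfaceRelator g} : Set (FreeGroup (Fin g ⊕ Fin g))),
      FreeGroup.lift φ r = 1 := by
    rintro r rfl
    simp [surfaceRelator, map_list_prod, List.map_ofFn, Function.comp_def, φ]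
  have hsurj : Function.Surjective (PresentedGroup.toGroup hr) := by
    rw [← MonoidHom.range_eq_top, eq_top_iff,
      ← Equiv.Perm.closure_prime_cycle_swap (σ := finRotate 5) (τ := Equiv.swap 0 1)
        (by simpa using Nat.prime_five) isCycle_finRotate support_finRotate ⟨0, 1, by decide, rfl⟩,
      Subgroup.closure_le]
    rintro x (rfl | rfl)
    · exact ⟨PresentedGroup.of (Sum.inl ⟨0, by omega⟩), by simp [φ]⟩
    · exact ⟨PresentedGroup.of (Sum.inl ⟨1, by omega⟩), by simp [φ]⟩
  exact Equiv.Perm.not_isSolvable_fin_5 (Group.isSolvable_of_surjective hsurj)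

theorem IsSurfaceGroup.not_isSolvable {Γ : Type*} [Group Γ] (hΓ : IsSurfaceGroup Γ) :
    ¬ Group.IsSolvable Γ := by
  obtain ⟨g, hg, ⟨e⟩⟩ := hΓ
  intro h
  exact not_isSolvable_genusGroup hg
    (Group.isSolvable_of_surjective (f := e.toMonoidHom) e.surjective)

/-! ### Solvability criteria read off from matrix entries -/

section Matrices

variable {Γ : Type*} [Group Γ]

theorem map_mul_apply (l : Γ →* GL (Fin 2) ℝ) (x y : Γ) (i j : Fin 2) :
    l (x * y) i j = l x i 0 * l y 0 j + l x i 1 * l y 1 j := by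
  simp [Matrix.mul_apply, Fin.sum_univ_two]

theorem det_ne_zero (g : GL (Fin 2) ℝ) : g 0 0 * g 1 1 - g 0 1 * g 1 0 ≠ 0 := by
  rw [← Matrix.det_fin_two]
  exact g.det_ne_zero

theorem commute_of_entries {l : Γ →* GL (Fin 2) ℝ} (hl : Function.Injective l) {x y : Γ}
    (h : ∀ i j, l (x * y) i j = l (y * x) i j) : Commute x y := by
  apply hl
  ext i j
  exact h i j

/-- Diagonal entries of triangular matrices multiply, so commutators are unipotent triangular, and
those commute. -/
theorem isSolvable_of_triangular {l : Γ →* GL (Fin 2) ℝ} (hl : Function.Injective l)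
    (h : (∀ x, l x 1 0 = 0) ∨ ∀ x, l x 0 1 = 0) : Group.IsSolvable Γ := by
  have hdet : ∀ x, l x 0 0 ≠ 0 ∧ l x 1 1 ≠ 0 := by
    intro x
    have dx := det_ne_zero (l x)
    rcases h with h | h <;> simpa [h] using dx
  have key : ∀ x y : Γ, l ⁅x, y⁆ 0 0 = 1 ∧ l ⁅x, y⁆ 1 1 = 1 := by
    intro x y
    -- This form of the commutator avoids entries of inverse matrices.
    have e : ⁅x, y⁆ * (y * x) = x * y := by rw [commutatorElement_def]; group
    have e0 := congrArg (fun z => l z 0 0) e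
    have e1 := congrArg (fun z => l z 1 1) e
    obtain ⟨x0, x1⟩ := hdet x
    obtain ⟨y0, y1⟩ := hdet y
    constructor
    · apply mul_right_cancel₀ (mul_ne_zero y0 x0)
      rcases h with h | h <;>
        simp only [map_mul_apply, h, mul_zero, add_zero, zero_mul] at e0 <;> linarith
    · apply mul_right_cancel₀ (mul_ne_zero y1 x1)
      rcases h with h | h <;>
        simp only [map_mul_apply, h, mul_zero, zero_mul, zero_add] at e1 <;> linarith
  apply isSolvable_of_commutators_commute
  intro x y z w
  apply commute_of_entries hl
  intro i j
  rw [map_mul_apply, map_mul_apply]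
  rcases h with h | h <;> fin_cases i <;> fin_cases j <;>
    simp [key, h, add_comm, -map_commutatorElement]

/-- The diagonal elements form a subgroup of index at most two, so commutators are diagonal and
commute. -/
theorem isSolvable_of_monomial {l : Γ →* GL (Fin 2) ℝ} (hl : Function.Injective l)
    (h : ∀ x, (l x 0 1 = 0 ∧ l x 1 0 = 0) ∨ (l x 0 0 = 0 ∧ l x 1 1 = 0)) : Group.IsSolvable Γ := by
  have key : ∀ x y : Γ, l ⁅x, y⁆ 0 1 = 0 ∧ l ⁅x, y⁆ 1 0 = 0 := by
    intro x y
    have e : ⁅x, y⁆ * (y * x) = x * y := by rw [commutatorElement_def]; group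
    have e0 := fun i j => congrArg (fun z => l z i j) e
    have e00 := e0 0 0
    have e01 := e0 0 1
    have e10 := e0 1 0
    have e11 := e0 1 1
    have dx := det_ne_zero (l x)
    have dy := det_ne_zero (l y)
    have dk := det_ne_zero (l ⁅x, y⁆)
    simp only [map_mul_apply] at e00 e01 e10 e11
    rcases h x with ⟨h1, h2⟩ | ⟨h1, h2⟩ <;> rcases h y with ⟨h3, h4⟩ | ⟨h3, h4⟩ <;>
      rcases h ⁅x, y⁆ with ⟨h5, h6⟩ | ⟨h5, h6⟩ <;>
      simp_all
  apply isSolvable_of_commutators_commute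
  intro x y z w
  apply commute_of_entries hl
  intro i j
  rw [map_mul_apply, map_mul_apply]
  fin_cases i <;> fin_cases j <;> simp [key, mul_comm, -map_commutatorElement]

/-- In a linear group that is not solvable some element has no zero among three of its entries. -/
theorem exists_entries_ne_zero {l : Γ →* GL (Fin 2) ℝ} (hl : Function.Injective l)
    (hΓ : ¬ Group.IsSolvable Γ) : ∃ x, l x 0 0 ≠ 0 ∧ l x 0 1 ≠ 0 ∧ l x 1 0 ≠ 0 := by
  have h0 : ∃ x, l x 0 1 ≠ 0 ∧ l x 1 0 ≠ 0 ∧ (l x 0 0 ≠ 0 ∨ l x 1 1 ≠ 0) := by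
    by_contra! hc
    obtain ⟨x, hx⟩ : ∃ x, l x 1 0 ≠ 0 := by
      by_contra! h; exact hΓ (isSolvable_of_triangular hl (.inl h))
    obtain ⟨y, hy⟩ : ∃ x, l x 0 1 ≠ 0 := by
      by_contra! h; exact hΓ (isSolvable_of_triangular hl (.inr h))
    obtain ⟨u, hu1, hu2⟩ : ∃ x, l x 0 1 ≠ 0 ∧ l x 1 0 ≠ 0 := by
      by_cases hx' : l x 0 1 = 0
      · by_cases hy' : l y 1 0 = 0
        · have dx := det_ne_zero (l x)
          have dy := det_ne_zero (l y)
          refine ⟨x * y, ?_, ?_⟩ <;> rw [map_mul_apply] <;> simp_all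
        · exact ⟨y, hy, hy'⟩
      · exact ⟨x, hx', hx⟩
    obtain ⟨hu3, hu4⟩ := hc u hu1 hu2
    apply hΓ
    apply isSolvable_of_monomial hl
    intro w
    -- Here `u` is antidiagonal. A non-monomial `w` has, by `hc`, a zero off-diagonal entry, hence
    -- nonzero diagonal ones; left multiplication by `u` swaps the rows up to scaling, so `u * w`
    -- contradicts `hc`.
    by_contra! hw
    have dw := det_ne_zero (l w)
    have c1 := hc w
    have c2 := hc (u * w)
    simp only [map_mul_apply, hu3, hu4] at c2
    by_cases w1 : l w 0 1 = 0 <;> by_cases w2 : l w 1 0 = 0 <;> simp_all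
  obtain ⟨x, h1, h2, h3⟩ := h0
  by_cases h : l x 0 0 = 0
  · have h4 : l x 1 1 ≠ 0 := by tauto
    -- Inversion exchanges the diagonal entries up to a nonzero factor.
    refine ⟨x⁻¹, ?_⟩
    have d := det_ne_zero (l x)
    have e : x⁻¹ * x = 1 := by simp
    have e0 := fun i j => congrArg (fun z => l z i j) e
    have e00 := e0 0 0
    have e01 := e0 0 1
    have e10 := e0 1 0
    have e11 := e0 1 1
    simp only [map_mul_apply, map_one, Units.val_one, Matrix.one_apply] at e00 e01 e10 e11
    simp [h] at e00 e01 e10 e11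
    refine ⟨?_, ?_, ?_⟩ <;> intro h0 <;> simp_all
  · exact ⟨x, h, h1, h2⟩

end Matrices

section

/-! ### Conjugation and normal forms -/

section Conjugation

variable {Γ : Type*} [Group Γ]

/-- The representation `l` conjugated by `P`. -/
def conjRep (P : GL (Fin 2) ℝ) (l : Γ →* GL (Fin 2) ℝ) : Γ →* GL (Fin 2) ℝ :=
  (MulAut.conj P).toMonoidHom.comp l

theorem conjRep_apply (P : GL (Fin 2) ℝ) (l : Γ →* GL (Fin 2) ℝ) (x : Γ) :
    conjRep P l x = P * l x * P⁻¹ := rfl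

theorem conjRep_injective (P : GL (Fin 2) ℝ) {l : Γ →* GL (Fin 2) ℝ} (hl : Function.Injective l) :
    Function.Injective (conjRep P l) :=
  (MulAut.conj P).injective.comp hl

theorem det_conj (P g : GL (Fin 2) ℝ) :
    (P * g * P⁻¹) 0 0 * (P * g * P⁻¹) 1 1 - (P * g * P⁻¹) 0 1 * (P * g * P⁻¹) 1 0 =
      g 0 0 * g 1 1 - g 0 1 * g 1 0 := by
  rw [← Matrix.det_fin_two, ← Matrix.det_fin_two]
  exact Matrix.det_units_conj P g

theorem trace_conj (P g : GL (Fin 2) ℝ) :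
    (P * g * P⁻¹) 0 0 + (P * g * P⁻¹) 1 1 = g 0 0 + g 1 1 := by
  rw [← Matrix.trace_fin_two, ← Matrix.trace_fin_two]
  exact Matrix.trace_units_conj P g

/-- An invertible matrix with a real eigenvalue is conjugate to an upper triangular one. -/
theorem exists_conj_upperTriangular (g : GL (Fin 2) ℝ) (hc : g 1 0 ≠ 0) (r : ℝ)
    (hr : r ^ 2 - (g 0 0 + g 1 1) * r + (g 0 0 * g 1 1 - g 0 1 * g 1 0) = 0) :
    ∃ P : GL (Fin 2) ℝ, (P * g * P⁻¹) 1 0 = 0 ∧ (P * g * P⁻¹) 0 1 ≠ 0 := by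
  -- The columns are an eigenvector for `r` and the first basis vector.
  let Q : GL (Fin 2) ℝ := Matrix.GeneralLinearGroup.mkOfDetNeZero !![r - g 1 1, 1; g 1 0, 0]
    (by simp [Matrix.det_fin_two, hc])
  have hQ : (Q : Matrix (Fin 2) (Fin 2) ℝ) = !![r - g 1 1, 1; g 1 0, 0] := rfl
  refine ⟨Q⁻¹, ?_⟩
  set Y := Q⁻¹ * g * Q⁻¹⁻¹ with hY
  have e : Q * Y = g * Q := by rw [hY]; group
  have e' : ∀ i j, (Q * Y) i j = (g * Q) i j := fun i j => by rw [e]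
  have e00 := e' 0 0
  have e10 := e' 1 0
  have e11 := e' 1 1
  simp only [Units.val_mul, Matrix.mul_apply, Fin.sum_univ_two, hQ] at e00 e10 e11
  simp at e00 e10 e11
  have h0 : Y 0 0 = r := by
    apply mul_left_cancel₀ hc
    linarith
  rw [h0] at e00
  refine ⟨by linear_combination e00 - hr, fun h => hc ?_⟩
  rw [h, mul_zero] at e11
  exact e11.symm

theorem exists_eigenvector {g : GL (Fin 2) ℝ} (hdet : g 0 0 * g 1 1 - g 0 1 * g 1 0 = 1) {s : ℝ}
    (hs : s ^ 2 - (g 0 0 + g 1 1) * s + 1 = 0) : ∃ u : Fin 2 → ℝ, u ≠ 0 ∧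
      g 0 0 * u 0 + g 0 1 * u 1 = s * u 0 ∧ g 1 0 * u 0 + g 1 1 * u 1 = s * u 1 := by
  obtain ⟨u, hu0, hu⟩ := (Matrix.exists_mulVec_eq_zero_iff
    (M := !![g 0 0 - s, g 0 1; g 1 0, g 1 1 - s])).2
    (by rw [Matrix.det_fin_two]; simp; linear_combination hs + hdet)
  have u0 := congrFun hu 0
  have u1 := congrFun hu 1
  simp [Matrix.mulVec, dotProduct, Fin.sum_univ_two] at u0 u1
  exact ⟨u, hu0, by linarith, by linarith⟩

/-- A matrix of determinant one with `|tr| > 2` is conjugate to a diagonal matrix. -/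
theorem exists_conj_diagonal (g : GL (Fin 2) ℝ) (hdet : g 0 0 * g 1 1 - g 0 1 * g 1 0 = 1)
    (htr : 4 < (g 0 0 + g 1 1) ^ 2) : ∃ (P : GL (Fin 2) ℝ) (r : ℝ), 1 < |r| ∧
      ((P * g * P⁻¹ : GL (Fin 2) ℝ) : Matrix (Fin 2) (Fin 2) ℝ) = !![r, 0; 0, r⁻¹] := by
  -- The root of larger absolute value has the sign of the trace; the other root is `r⁻¹`.
  obtain ⟨r, hr1, hr⟩ : ∃ r : ℝ, 1 < |r| ∧ r ^ 2 - (g 0 0 + g 1 1) * r + 1 = 0 := by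
    set t := g 0 0 + g 1 1
    have hs : √(t ^ 2 - 4) ^ 2 = t ^ 2 - 4 := Real.sq_sqrt (by linarith)
    have hs0 : 0 ≤ √(t ^ 2 - 4) := Real.sqrt_nonneg _
    rcases le_total 0 t with h | h
    · refine ⟨(t + √(t ^ 2 - 4)) / 2, ?_, by linear_combination hs / 4⟩
      rw [lt_abs]
      left
      nlinarith
    · refine ⟨(t - √(t ^ 2 - 4)) / 2, ?_, by linear_combination hs / 4⟩
      rw [lt_abs]
      right
      nlinarith
  have hr0 : r ≠ 0 := by rintro rfl; norm_num at hr1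
  have hr2 : r - r⁻¹ ≠ 0 := by
    intro h
    have h' : r ^ 2 = 1 := by field_simp at h; linarith
    rw [← sq_abs] at h'
    nlinarith
  obtain ⟨u, hu, u0, u1⟩ := exists_eigenvector hdet hr
  obtain ⟨v, hv, v0, v1⟩ := exists_eigenvector hdet (s := r⁻¹)
    (by field_simp; linear_combination hr)
  have hd : u 0 * v 1 - v 0 * u 1 ≠ 0 := by
    intro hd
    have h00 : u 0 * v 0 = 0 := by
      apply mul_left_cancel₀ hr2
      linear_combination u 0 * v0 - v 0 * u0 - g 0 1 * hd
    have h11 : u 1 * v 1 = 0 := by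
      apply mul_left_cancel₀ hr2
      linear_combination u 1 * v1 - v 1 * u1 + g 1 0 * hd
    have hu' : u 0 ≠ 0 ∨ u 1 ≠ 0 := by
      by_contra! h
      exact hu (by ext i; fin_cases i <;> simp [h])
    have hv' : v 0 ≠ 0 ∨ v 1 ≠ 0 := by
      by_contra! h
      exact hv (by ext i; fin_cases i <;> simp [h])
    rcases mul_eq_zero.1 h00 with h | h <;> rcases mul_eq_zero.1 h11 with h' | h' <;>
      simp_all
  let Q : GL (Fin 2) ℝ := Matrix.GeneralLinearGroup.mkOfDetNeZero !![u 0, v 0; u 1, v 1]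
    (by simpa [Matrix.det_fin_two] using hd)
  have hQ : (Q : Matrix (Fin 2) (Fin 2) ℝ) = !![u 0, v 0; u 1, v 1] := rfl
  refine ⟨Q⁻¹, r, hr1, ?_⟩
  have e : (g : Matrix (Fin 2) (Fin 2) ℝ) * Q = Q * !![r, 0; 0, r⁻¹] := by
    rw [hQ]
    ext i j
    fin_cases i <;> fin_cases j <;> simp [Matrix.mul_apply, Fin.sum_univ_two] <;> linarith
  rw [inv_inv, mul_assoc, Units.val_mul, Units.val_mul, e, Units.inv_mul_cancel_left]

end Conjugation

/-! ### Existence of hyperbolic elements -/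

/-- If `X ∈ SL₂(ℝ)` is elliptic and `tr [X, Y] ≤ 2`, then `X` and `Y` commute. Here
`X = (a, b; c, d)` and `Y = (p, q; r, s)`. -/
theorem commute_of_elliptic {a b c d p q r s : ℝ} (hx : a * d - b * c = 1)
    (ht : (a + d) ^ 2 < 4)
    (hW : (b * r - c * q) ^ 2 + (a * q + b * s - p * b - q * d) * (c * p + d * r - r * a - s * c)
      ≤ 0) :
    b ≠ 0 ∧ b * r = c * q ∧ b * (s - p) = q * (d - a) := by
  have hb : b ≠ 0 := by
    rintro rfl
    nlinarith [sq_nonneg (a - d)]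
  set w := b * r - c * q with hw
  set w₁ := a * q + b * s - p * b - q * d with hw₁
  set w₂ := c * p + d * r - r * a - s * c with hw₂
  -- With `K = XY - YX = (w, w₁; w₂, -w)` this is `tr (X K) = 0`. Eliminating `w₂` turns `-b² det K`
  -- into a form in `w`, `w₁` that is positive definite because `X` is elliptic.
  have ho : b * w₂ = - ((a - d) * w + c * w₁) := by rw [hw, hw₁, hw₂]; ring
  have h1 : b ^ 2 * (w ^ 2 + w₁ * w₂) =
      (b * w - (a - d) / 2 * w₁) ^ 2 + (1 - (a + d) ^ 2 / 4) * w₁ ^ 2 := by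
    linear_combination b * w₁ * ho + w₁ ^ 2 * hx
  have h2 : b ^ 2 * (w ^ 2 + w₁ * w₂) ≤ 0 := mul_nonpos_of_nonneg_of_nonpos (sq_nonneg b) hW
  have h3 : 0 < 1 - (a + d) ^ 2 / 4 := by linarith
  have h4 : w₁ = 0 := by
    have : w₁ ^ 2 ≤ 0 := by
      by_contra! h
      nlinarith [mul_pos h3 h, sq_nonneg (b * w - (a - d) / 2 * w₁)]
    exact pow_eq_zero_iff (two_ne_zero) |>.1 (le_antisymm this (sq_nonneg _))
  have h5 : w = 0 := by
    rw [h4] at h1 h2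
    have h6 : (b * w) ^ 2 ≤ 0 := by nlinarith
    have h7 : b * w = 0 := pow_eq_zero_iff (two_ne_zero) |>.1 (le_antisymm h6 (sq_nonneg _))
    exact (mul_eq_zero.1 h7).resolve_left hb
  exact ⟨hb, by linarith, by linarith⟩

variable {Γ : Type*} [Group Γ]

/-- If the traces of `Xⁿ Y` stay bounded, where `X` is parabolic and upper triangular, then `Y` is
upper triangular. -/
theorem apply_one_zero_eq_zero_of_parabolic (m : Γ →* GL (Fin 2) ℝ) {x : Γ} (h10 : m x 1 0 = 0)
    (h01 : m x 0 1 ≠ 0) (hd : m x 0 0 * m x 1 1 = 1) (ht : (m x 0 0 + m x 1 1) ^ 2 = 4) (y : Γ)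
    (hy : ∀ n : ℕ, (m ((x * x) ^ n * y) 0 0 + m ((x * x) ^ n * y) 1 1) ^ 2 ≤ 4) :
    m y 1 0 = 0 := by
  have hps : m x 0 0 = m x 1 1 := by
    have : (m x 0 0 - m x 1 1) ^ 2 = 0 := by linear_combination ht - 4 * hd
    linarith [pow_eq_zero_iff two_ne_zero |>.1 this]
  -- Squaring `x` removes the sign of its eigenvalue: `(x * x) ^ n` is unipotent with upper right
  -- entry `n t`, so the trace of its product with `y` is affine in `n`, with slope `t * m y 1 0`.
  set t := 2 * m x 0 0 * m x 0 1 with ht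
  have ht0 : t ≠ 0 := by
    have : m x 0 0 ≠ 0 := left_ne_zero_of_mul_eq_one hd
    positivity
  have hpow : ∀ n : ℕ, m ((x * x) ^ n) 0 0 = 1 ∧ m ((x * x) ^ n) 1 1 = 1 ∧
      m ((x * x) ^ n) 1 0 = 0 ∧ m ((x * x) ^ n) 0 1 = n * t := by
    intro n
    induction n with
    | zero => simp
    | succ n ih =>
      obtain ⟨h1, h2, h3, h4⟩ := ih
      rw [pow_succ]
      simp only [map_mul_apply m ((x * x) ^ n), map_mul_apply m x, h1, h2, h3, h4, h10]
      rw [← hps] at hd ⊢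
      push_cast
      refine ⟨?_, ?_, ?_, ?_⟩ <;> try linear_combination hd
      · ring
      · rw [ht]; linear_combination n * (2 * m x 0 0 * m x 0 1) * hd
  by_contra hk
  have hbd : ∀ n : ℕ, (m y 0 0 + m y 1 1 + n * (t * m y 1 0)) ^ 2 ≤ 4 := by
    intro n
    obtain ⟨h1, h2, h3, h4⟩ := hpow n
    have := hy n
    simp only [map_mul_apply m ((x * x) ^ n), h1, h2, h3, h4] at this
    convert this using 2
    ring
  have hk0 : 0 < |t * m y 1 0| := abs_pos.2 (mul_ne_zero ht0 hk)
  obtain ⟨n, hn⟩ := exists_nat_gt ((2 + |m y 0 0 + m y 1 1|) / |t * m y 1 0|)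
  rw [div_lt_iff₀ hk0] at hn
  have h1 : |m y 0 0 + m y 1 1 + n * (t * m y 1 0)| ≤ 2 := by
    apply abs_le_of_sq_le_sq _ (by norm_num)
    linarith [hbd n]
  have h2 := abs_sub (m y 0 0 + m y 1 1 + n * (t * m y 1 0)) (m y 0 0 + m y 1 1)
  rw [add_sub_cancel_left, abs_mul, Nat.abs_cast] at h2
  linarith

/-- A non-solvable subgroup of `SL₂(ℝ)` contains a hyperbolic element. -/
theorem exists_hyperbolic {l : Γ →* GL (Fin 2) ℝ} (hl : Function.Injective l)
    (hdet : ∀ x, l x 0 0 * l x 1 1 - l x 0 1 * l x 1 0 = 1) (hΓ : ¬ Group.IsSolvable Γ) :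
    ∃ x, 4 < (l x 0 0 + l x 1 1) ^ 2 := by
  by_contra! hc
  apply hΓ
  obtain ⟨x, hx⟩ : ∃ x, l x 1 0 ≠ 0 := by
    by_contra! h
    exact hΓ (isSolvable_of_triangular hl (.inl h))
  rcases (hc x).lt_or_eq with ht | ht
  · have key : ∀ y, l x 0 1 ≠ 0 ∧ l x 0 1 * l y 1 0 = l x 1 0 * l y 0 1 ∧
        l x 0 1 * (l y 1 1 - l y 0 0) = l y 0 1 * (l x 1 1 - l x 0 0) := by
      intro y
      apply commute_of_elliptic (hdet x) ht
      have e : ⁅x, y⁆ * (y * x) = x * y := by rw [commutatorElement_def]; group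
      have dM := hdet (y * x)
      have dN := hdet (x * y)
      have hk : l ⁅x, y⁆ 0 0 + l ⁅x, y⁆ 1 1 ≤ 2 := by
        nlinarith [hc ⁅x, y⁆]
      have e0 := fun i j => congrArg (fun z => l z i j) e
      have e00 := e0 0 0
      have e01 := e0 0 1
      have e10 := e0 1 0
      have e11 := e0 1 1
      have f : ∀ i j, l (⁅x, y⁆ * (y * x)) i j =
        l ⁅x, y⁆ i 0 * l (y * x) 0 j + l ⁅x, y⁆ i 1 * l (y * x) 1 j := map_mul_apply l _ _
      simp only [f] at e00 e01 e10 e11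
      -- `XY - YX = ([X, Y] - 1) YX`, and `det (k - 1) = 2 - tr k` in `SL₂`.
      have hW : (l (x * y) 0 0 - l (y * x) 0 0) * (l (x * y) 1 1 - l (y * x) 1 1) -
          (l (x * y) 0 1 - l (y * x) 0 1) * (l (x * y) 1 0 - l (y * x) 1 0) =
          2 - (l ⁅x, y⁆ 0 0 + l ⁅x, y⁆ 1 1) := by
        rw [← e00, ← e01, ← e10, ← e11] at dN ⊢
        linear_combination dN + (1 - l ⁅x, y⁆ 0 0 - l ⁅x, y⁆ 1 1) * dM
      simp only [map_mul_apply] at hW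
      nlinarith
    -- Everything commutes with the non-scalar matrix `l x`, whose centralizer is abelian.
    apply Group.isSolvable_of_comm
    intro y z
    obtain ⟨hb, hy1, hy2⟩ := key y
    obtain ⟨-, hz1, hz2⟩ := key z
    refine commute_of_entries hl fun i j => ?_
    rw [map_mul_apply, map_mul_apply]
    apply mul_left_cancel₀ hb
    fin_cases i <;> fin_cases j <;> simp only [Fin.mk_one, Fin.zero_eta]
    · linear_combination l y 0 1 * hz1 - l z 0 1 * hy1
    · linear_combination l y 0 1 * hz2 - l z 0 1 * hy2
    · apply mul_left_cancel₀ hb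
      linear_combination -(l x 0 1 * l y 1 0) * hz2 - l z 0 1 * (l x 1 1 - l x 0 0) * hy1 +
        l x 0 1 * (l y 1 1 - l y 0 0) * hz1 + l x 1 0 * l z 0 1 * hy2
    · linear_combination l z 0 1 * hy1 - l y 0 1 * hz1
  · obtain ⟨P, hP0, hP1⟩ := exists_conj_upperTriangular (l x) hx ((l x 0 0 + l x 1 1) / 2)
      (by linear_combination hdet x - ht / 4)
    refine isSolvable_of_triangular (conjRep_injective P hl) (.inl fun y => ?_)
    have htr : ∀ y, (conjRep P l y 0 0 + conjRep P l y 1 1) ^ 2 ≤ 4 := by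
      intro y
      rw [conjRep_apply, trace_conj]
      exact hc y
    have hd : conjRep P l x 0 0 * conjRep P l x 1 1 - conjRep P l x 0 1 * conjRep P l x 1 0 =
        1 := by
      rw [conjRep_apply, det_conj]
      exact hdet x
    have ht' : (conjRep P l x 0 0 + conjRep P l x 1 1) ^ 2 = 4 := by
      rw [conjRep_apply, trace_conj]
      exact ht
    rw [← conjRep_apply] at hP0 hP1
    generalize conjRep P l = m at *
    exact apply_one_zero_eq_zero_of_parabolic m hP0 hP1 (by simpa [hP0] using hd) ht' y
      fun n => htr _

end

/-! ### Continuous multiplicative functions on the line -/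

section MultiplicativeFunctions

/-- `s` is a nonzero number by which `ψ` is multiplicative: `ψ (s t) = ψ s * ψ t` for `t ≠ 0`. -/
def IsMultiplier (ψ : ℝ → ℝ) (s : ℝ) : Prop :=
  s ≠ 0 ∧ ∀ t, t ≠ 0 → ψ (s * t) = ψ s * ψ t

variable {ψ : ℝ → ℝ}

theorem IsMultiplier.mul {s t : ℝ} (hs : IsMultiplier ψ s) (ht : IsMultiplier ψ t) :
    IsMultiplier ψ (s * t) := by
  refine ⟨mul_ne_zero hs.1 ht.1, fun u hu => ?_⟩
  rw [mul_assoc, hs.2 _ (mul_ne_zero ht.1 hu), ht.2 _ hu, hs.2 _ ht.1, mul_assoc]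

theorem IsMultiplier.map_inv {s : ℝ} (h1 : ψ 1 = 1) (hs : IsMultiplier ψ s) :
    ψ s * ψ s⁻¹ = 1 := by
  rw [← hs.2 _ (inv_ne_zero hs.1), mul_inv_cancel₀ hs.1, h1]

theorem IsMultiplier.inv {s : ℝ} (h1 : ψ 1 = 1) (hs : IsMultiplier ψ s) :
    IsMultiplier ψ s⁻¹ := by
  refine ⟨inv_ne_zero hs.1, fun t ht => ?_⟩
  have h2 := hs.map_inv h1
  have h3 := hs.2 (s⁻¹ * t) (mul_ne_zero (inv_ne_zero hs.1) ht)
  rw [mul_inv_cancel_left₀ hs.1] at h3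
  apply mul_left_cancel₀ (left_ne_zero_of_mul_eq_one h2)
  rw [← h3, ← mul_assoc, h2, one_mul]

theorem IsMultiplier.map_div {s t : ℝ} (h1 : ψ 1 = 1) (hs : IsMultiplier ψ s)
    (ht : IsMultiplier ψ t) : ψ (s / t) = ψ s / ψ t := by
  rw [div_eq_mul_inv, hs.2 _ (inv_ne_zero ht.1), div_eq_mul_inv,
    eq_inv_of_mul_eq_one_right (ht.map_inv h1)]

theorem IsMultiplier.of_tendsto (hψ : ∀ t, t ≠ 0 → ContinuousAt ψ t) {u : ℕ → ℝ} {s : ℝ}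
    (hs : s ≠ 0) (hu : ∀ n, IsMultiplier ψ (u n)) (h : Tendsto u atTop (𝓝 s)) :
    IsMultiplier ψ s := by
  refine ⟨hs, fun t ht => ?_⟩
  have l1 : Tendsto (fun n => ψ (u n * t)) atTop (𝓝 (ψ (s * t))) :=
    (hψ _ (mul_ne_zero hs ht)).tendsto.comp (h.mul_const t)
  have l2 : Tendsto (fun n => ψ (u n) * ψ t) atTop (𝓝 (ψ s * ψ t)) :=
    ((hψ _ hs).tendsto.comp h).mul_const _
  refine tendsto_nhds_unique l1 (l2.congr fun n => ?_)
  exact ((hu n).2 t ht).symm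

/-- The logarithms of the positive multipliers. -/
def logMultipliers (h1 : ψ 1 = 1) : AddSubgroup ℝ where
  carrier := {x | IsMultiplier ψ (Real.exp x)}
  zero_mem' := by
    change IsMultiplier ψ (Real.exp 0)
    rw [Real.exp_zero]
    exact ⟨one_ne_zero, fun t _ => by rw [one_mul, h1, one_mul]⟩
  add_mem' {x y} hx hy := by
    change IsMultiplier ψ (Real.exp (x + y))
    rw [Real.exp_add]
    exact IsMultiplier.mul hx hy
  neg_mem' {x} hx := by
    change IsMultiplier ψ (Real.exp (-x))
    rw [Real.exp_neg]
    exact IsMultiplier.inv h1 hx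

theorem tendsto_one_add_mul_pow {x ε : ℝ} (hε0 : 0 < ε) (hε1 : ε < 1) :
    Tendsto (fun n : ℕ => 1 + x * ε ^ n) atTop (𝓝 1) := by
  simpa using ((tendsto_pow_atTop_nhds_zero_of_lt_one hε0.le hε1).const_mul x).const_add 1

/-- The given multipliers differ from `1` and tend to it, so the group of logarithms is not
discrete, hence dense; continuity of `ψ` makes the multipliers closed away from `0`. -/
theorem isMultiplier_of_pos (h1 : ψ 1 = 1) (hψ : ∀ t, t ≠ 0 → ContinuousAt ψ t) {x ε : ℝ}
    (hx : x ≠ 0) (hε0 : 0 < ε) (hε1 : ε < 1)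
    (h : ∀ᶠ n : ℕ in atTop, IsMultiplier ψ (1 + x * ε ^ n)) {s : ℝ} (hs : 0 < s) :
    IsMultiplier ψ s := by
  have hlim := tendsto_one_add_mul_pow (x := x) hε0 hε1
  have hdense : Dense (logMultipliers h1 : Set ℝ) := by
    apply AddSubgroup.dense_of_not_isolated_zero
    intro η hη
    have hlog : Tendsto (fun n : ℕ => |Real.log (1 + x * ε ^ n)|) atTop (𝓝 0) := by
      have := ((Real.continuousAt_log one_ne_zero).tendsto.comp hlim).abs
      simpa using this
    obtain ⟨n, ⟨hn1, hn2⟩, hn3⟩ := ((h.and (hlim.eventually_const_lt one_pos)).and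
      (hlog.eventually_lt_const hη)).exists
    have hmem : Real.log (1 + x * ε ^ n) ∈ logMultipliers h1 := by
      change IsMultiplier ψ _
      rwa [Real.exp_log hn2]
    have hne : Real.log (1 + x * ε ^ n) ≠ 0 := by
      intro h0
      have := Real.exp_log hn2
      rw [h0, Real.exp_zero] at this
      have : x * ε ^ n = 0 := by linarith
      exact mul_ne_zero hx (pow_ne_zero _ hε0.ne') this
    exact ⟨_, abs_mem_iff.2 hmem, abs_pos.2 hne, hn3⟩
  obtain ⟨u, hu, hul⟩ := mem_closure_iff_seq_limit.1 (hdense (Real.log s))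
  refine IsMultiplier.of_tendsto hψ hs.ne' hu ?_
  have := (Real.continuous_exp.tendsto _).comp hul
  rwa [Real.exp_log hs] at this

/-- Square roots make `ψ` positive on positive reals, so `log ∘ ψ ∘ exp` is a continuous additive
map, hence linear. -/
theorem exists_eq_rpow (hψ : ∀ t, t ≠ 0 → ContinuousAt ψ t) (hψ0 : ∀ t, t ≠ 0 → ψ t ≠ 0)
    (h : ∀ s, 0 < s → IsMultiplier ψ s) : ∃ α : ℝ, ∀ s, 0 < s → ψ s = s ^ α := by
  have hpos : ∀ s, 0 < s → 0 < ψ s := by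
    intro s hs
    have hs' := Real.sqrt_pos.2 hs
    rw [← Real.mul_self_sqrt hs.le, (h _ hs').2 _ hs'.ne']
    exact mul_self_pos.2 (hψ0 _ hs'.ne')
  let L : ℝ →+ ℝ := AddMonoidHom.mk' (fun x => Real.log (ψ (Real.exp x))) (by
    intro x y
    rw [Real.exp_add, (h _ (Real.exp_pos x)).2 _ (Real.exp_ne_zero y),
      Real.log_mul (hpos _ (Real.exp_pos x)).ne' (hpos _ (Real.exp_pos y)).ne'])
  have hL : Continuous L := by
    rw [continuous_iff_continuousAt]
    intro x
    exact ((hψ _ (Real.exp_ne_zero x)).comp Real.continuous_exp.continuousAt).log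
      (hpos _ (Real.exp_pos x)).ne'
  refine ⟨L 1, fun s hs => ?_⟩
  have h1 := map_real_smul L hL (Real.log s) 1
  rw [smul_eq_mul, mul_one, smul_eq_mul] at h1
  rw [Real.rpow_def_of_pos hs, ← h1]
  change ψ s = Real.exp (Real.log (ψ (Real.exp (Real.log s))))
  rw [Real.exp_log hs, Real.exp_log (hpos s hs)]

/-- A power function that maps `1 + x εⁿ` to `1 + y δⁿ` for large `n` is the identity. -/
theorem rpow_exponent_eq_one {x y ε δ α : ℝ} (hx : x ≠ 0) (hε0 : 0 < ε) (hε1 : ε < 1)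
    (hδ1 : δ < 1) (hα : ε ^ α = δ)
    (h : ∀ᶠ n : ℕ in atTop, (1 + x * ε ^ n) ^ α = 1 + y * δ ^ n) : α = 1 := by
  have hα0 : α ≠ 0 := by
    rintro rfl
    rw [Real.rpow_zero] at hα
    exact hδ1.ne hα.symm
  have hder : HasDerivAt (fun s : ℝ => s ^ α) α 1 := by
    simpa using Real.hasDerivAt_rpow_const (x := 1) (p := α) (Or.inl one_ne_zero)
  have hlim : Tendsto (fun n : ℕ => 1 + x * ε ^ n) atTop (𝓝[≠] 1) := by
    refine tendsto_nhdsWithin_iff.2 ⟨tendsto_one_add_mul_pow hε0 hε1, .of_forall fun n => ?_⟩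
    have : x * ε ^ n ≠ 0 := mul_ne_zero hx (pow_ne_zero _ hε0.ne')
    simpa using this
  have hslope := (hasDerivAt_iff_tendsto_slope.1 hder).comp hlim
  -- These are the difference quotients of `s ^ α` at `1`. A geometric sequence with nonzero limit
  -- `α` has ratio one, so `δ = ε`.
  have hgeo : Tendsto (fun n : ℕ => y / x * (δ / ε) ^ n) atTop (𝓝 α) := by
    refine hslope.congr' ?_
    filter_upwards [h] with n hn
    simp only [Function.comp_apply, slope_def_field, hn, Real.one_rpow]
    rw [div_pow]
    have := pow_ne_zero n hε0.ne'
    field_simp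
    ring
  have hq : δ / ε = 1 := by
    have h1 := (tendsto_add_atTop_iff_nat 1).2 hgeo
    have h2 := hgeo.mul_const (δ / ε)
    have := tendsto_nhds_unique h1 (h2.congr fun n => by ring)
    field_simp at this
    rw [div_eq_one_iff_eq hε0.ne']
    linarith
  have h3 : α * Real.log ε = Real.log ε := by
    rw [← Real.log_rpow hε0, hα, (div_eq_one_iff_eq hε0.ne').1 hq]
  exact mul_right_cancel₀ (Real.log_neg hε0 hε1).ne (h3.trans (one_mul _).symm)

end MultiplicativeFunctions

/-! ### Equivariant homeomorphisms of the punctured plane -/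

section

variable {Γ : Type*} [Group Γ]

theorem gl_smul_apply (g : GL (Fin 2) ℝ) (p : Fin 2 → ℝ) (i : Fin 2) :
    (g • p) i = g i 0 * p 0 + g i 1 * p 1 := by
  change Matrix.mulVec (g : Matrix (Fin 2) (Fin 2) ℝ) p i = _
  simp [Matrix.mulVec, dotProduct, Fin.sum_univ_two]

theorem continuous_gl_smul (g : GL (Fin 2) ℝ) : Continuous fun p : Fin 2 → ℝ => g • p := by
  refine continuous_pi fun i => ?_
  simp only [gl_smul_apply]
  fun_prop

/-- An equivariant homeomorphism between the linear actions on `ℝ² ∖ {0}`, extended by `0 ↦ 0`. -/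
structure PlaneConj (l₁ l₂ : Γ →* GL (Fin 2) ℝ) where
  /-- The underlying bijection of the plane. -/
  toEquiv : (Fin 2 → ℝ) ≃ (Fin 2 → ℝ)
  map_zero : toEquiv 0 = 0
  continuousAt : ∀ p, p ≠ 0 → ContinuousAt toEquiv p
  continuousAt_symm : ∀ p, p ≠ 0 → ContinuousAt toEquiv.symm p
  map_smul : ∀ γ p, toEquiv (l₁ γ • p) = l₂ γ • toEquiv p

namespace PlaneConj

variable {l₁ l₂ : Γ →* GL (Fin 2) ℝ}

theorem map_ne_zero (F : PlaneConj l₁ l₂) {p : Fin 2 → ℝ} (hp : p ≠ 0) : F.toEquiv p ≠ 0 := by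
  rw [← F.map_zero]
  exact F.toEquiv.injective.ne hp

theorem symm_ne_zero (F : PlaneConj l₁ l₂) {p : Fin 2 → ℝ} (hp : p ≠ 0) :
    F.toEquiv.symm p ≠ 0 := by
  intro h
  apply hp
  rw [← F.toEquiv.apply_symm_apply p, h, F.map_zero]

/-- Change of bases in the source and in the target. -/
def conj (F : PlaneConj l₁ l₂) (P Q : GL (Fin 2) ℝ) :
    PlaneConj (conjRep P l₁) (conjRep Q l₂) where
  toEquiv := ((MulAction.toPerm P⁻¹).trans F.toEquiv).trans (MulAction.toPerm Q)
  map_zero := by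
    simp [F.map_zero]
  continuousAt p hp := by
    have hp' : P⁻¹ • p ≠ 0 := (smul_ne_zero_iff_ne _).2 hp
    exact (continuous_gl_smul Q).continuousAt.comp
      ((F.continuousAt _ hp').comp (continuous_gl_smul P⁻¹).continuousAt)
  continuousAt_symm p hp := by
    have hp' : Q⁻¹ • p ≠ 0 := (smul_ne_zero_iff_ne _).2 hp
    have := (continuous_gl_smul P).continuousAt.comp
      ((F.continuousAt_symm _ hp').comp (continuous_gl_smul Q⁻¹).continuousAt)
    exact this
  map_smul γ p := by
    change Q • F.toEquiv (P⁻¹ • conjRep P l₁ γ • p) =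
      conjRep Q l₂ γ • Q • F.toEquiv (P⁻¹ • p)
    rw [conjRep_apply, conjRep_apply, mul_smul, mul_smul, inv_smul_smul, F.map_smul, mul_smul,
      mul_smul, inv_smul_smul]

end PlaneConj

section Diagonal

theorem map_pow_diagonal {l : Γ →* GL (Fin 2) ℝ} {x : Γ} {r : ℝ}
    (h : (l x : Matrix (Fin 2) (Fin 2) ℝ) = !![r, 0; 0, r⁻¹]) (n : ℕ) :
    (l (x ^ n) : Matrix (Fin 2) (Fin 2) ℝ) = !![r ^ n, 0; 0, r⁻¹ ^ n] := by
  induction n with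
  | zero => ext i j; fin_cases i <;> fin_cases j <;> simp
  | succ n ih =>
    rw [pow_succ, map_mul, Units.val_mul, ih, h]
    ext i j
    fin_cases i <;> fin_cases j <;> simp [Matrix.mul_apply, Fin.sum_univ_two, pow_succ]

theorem map_inv_pow_diagonal {l : Γ →* GL (Fin 2) ℝ} {x : Γ} {r : ℝ} (hr : r ≠ 0)
    (h : (l x : Matrix (Fin 2) (Fin 2) ℝ) = !![r, 0; 0, r⁻¹]) (n : ℕ) :
    (l (x ^ n)⁻¹ : Matrix (Fin 2) (Fin 2) ℝ) = !![r⁻¹ ^ n, 0; 0, r ^ n] := by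
  rw [map_inv]
  apply Units.inv_eq_of_mul_eq_one_right
  rw [map_pow_diagonal h]
  ext i j
  fin_cases i <;> fin_cases j <;> simp [Matrix.mul_apply, Fin.sum_univ_two, hr]

variable {l₁ l₂ : Γ →* GL (Fin 2) ℝ} {x₀ : Γ} {μ ν : ℝ}

theorem tendsto_inv_pow {r : ℝ} (hr : 1 < |r|) :
    Tendsto (fun n : ℕ => r⁻¹ ^ n) atTop (𝓝 0) := by
  apply tendsto_pow_atTop_nhds_zero_of_abs_lt_one
  rw [abs_inv]
  exact inv_lt_one_of_one_lt₀ hr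

theorem tendsto_vec {u v : ℕ → ℝ} {a b : ℝ} (hu : Tendsto u atTop (𝓝 a))
    (hv : Tendsto v atTop (𝓝 b)) : Tendsto (fun n => ![u n, v n]) atTop (𝓝 ![a, b]) := by
  rw [tendsto_pi_nhds]
  intro i
  fin_cases i
  · simpa using hu
  · simpa using hv

theorem vec_ne_zero_left {a b : ℝ} (ha : a ≠ 0) : ![a, b] ≠ 0 := fun h => ha (congrFun h 0)

theorem vec_ne_zero_right {a b : ℝ} (hb : b ≠ 0) : ![a, b] ≠ 0 := fun h => hb (congrFun h 1)

theorem PlaneConj.tendsto_apply (F : PlaneConj l₁ l₂) {u : ℕ → Fin 2 → ℝ} {p : Fin 2 → ℝ}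
    (hp : p ≠ 0) (hu : Tendsto u atTop (𝓝 p)) (i : Fin 2) :
    Tendsto (fun n => F.toEquiv (u n) i) atTop (𝓝 (F.toEquiv p i)) :=
  (continuous_apply i).continuousAt.tendsto.comp ((F.continuousAt p hp).tendsto.comp hu)

/-- Expanding eigenlines are mapped to expanding eigenlines. -/
theorem PlaneConj.map_axis (F : PlaneConj l₁ l₂) (hμ : 1 < |μ|) (hν : 1 < |ν|)
    (h₁ : (l₁ x₀ : Matrix (Fin 2) (Fin 2) ℝ) = !![μ, 0; 0, μ⁻¹])
    (h₂ : (l₂ x₀ : Matrix (Fin 2) (Fin 2) ℝ) = !![ν, 0; 0, ν⁻¹]) {t : ℝ} (ht : t ≠ 0) :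
    F.toEquiv ![t, 0] 1 = 0 := by
  have hμ0 : μ ≠ 0 := by rintro rfl; norm_num at hμ
  -- Points tending to `(0, 1)` are carried to points tending to `(t, 0)`. In the target, the second
  -- coordinates of the images are contracted by `ν⁻¹ ^ n`.
  have e : ∀ n : ℕ, l₁ (x₀ ^ n) • ![μ⁻¹ ^ n * t, 1] = ![t, μ⁻¹ ^ n] := by
    intro n
    have : μ ^ n * (μ⁻¹ ^ n * t) = t := by
      rw [← mul_assoc, ← mul_pow, mul_inv_cancel₀ hμ0, one_pow, one_mul]
    ext i
    rw [gl_smul_apply, map_pow_diagonal h₁]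
    fin_cases i <;> simp
    simpa using this
  have e' : ∀ n : ℕ, F.toEquiv ![t, μ⁻¹ ^ n] 1 = ν⁻¹ ^ n * F.toEquiv ![μ⁻¹ ^ n * t, 1] 1 := by
    intro n
    rw [← e, F.map_smul, gl_smul_apply, map_pow_diagonal h₂]
    simp
  have t1 := F.tendsto_apply (vec_ne_zero_left ht)
    (tendsto_vec (tendsto_const_nhds (x := t)) (tendsto_inv_pow hμ)) 1
  have t2 := (tendsto_inv_pow hν).mul (F.tendsto_apply (p := ![0, 1])
    (vec_ne_zero_right one_ne_zero) (tendsto_vec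
    (by simpa only [zero_mul] using (tendsto_inv_pow hμ).mul_const t)
    (tendsto_const_nhds (x := (1 : ℝ)))) 1)
  rw [zero_mul] at t2
  exact tendsto_nhds_unique t1 (t2.congr fun n => (e' n).symm)

/-- The action of `F` on the axis of `x₀` intertwines the upper left entries. -/
theorem PlaneConj.map_axis_mul (F : PlaneConj l₁ l₂) (hμ : 1 < |μ|) (hν : 1 < |ν|)
    (h₁ : (l₁ x₀ : Matrix (Fin 2) (Fin 2) ℝ) = !![μ, 0; 0, μ⁻¹])
    (h₂ : (l₂ x₀ : Matrix (Fin 2) (Fin 2) ℝ) = !![ν, 0; 0, ν⁻¹]) {t : ℝ} (ht : t ≠ 0) (y : Γ)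
    (hy : l₁ y 0 0 ≠ 0) :
    F.toEquiv ![l₁ y 0 0 * t, 0] 0 = l₂ y 0 0 * F.toEquiv ![t, 0] 0 := by
  have hμ0 : μ ≠ 0 := by rintro rfl; norm_num at hμ
  have hν0 : ν ≠ 0 := by rintro rfl; norm_num at hν
  -- Conjugation by `x₀ ^ n` keeps the upper left entry and shrinks the lower left one by `μ⁻²ⁿ`.
  have e : ∀ n : ℕ, l₁ (x₀ ^ n * y * (x₀ ^ n)⁻¹) • ![t, 0] =
      ![l₁ y 0 0 * t, μ⁻¹ ^ n * μ⁻¹ ^ n * (l₁ y 1 0 * t)] := by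
    intro n
    have : μ ^ n * μ⁻¹ ^ n = 1 := by rw [← mul_pow, mul_inv_cancel₀ hμ0, one_pow]
    ext i
    rw [map_mul, map_mul, mul_smul, mul_smul]
    simp only [gl_smul_apply, map_pow_diagonal h₁,
      map_inv_pow_diagonal hμ0 h₁]
    fin_cases i
    · simp only [Fin.zero_eta, Matrix.of_apply, Matrix.cons_val]
      linear_combination l₁ y 0 0 * t * this
    · simp only [Fin.mk_one, Matrix.of_apply, Matrix.cons_val]
      ring
  have e' : ∀ n : ℕ, F.toEquiv ![l₁ y 0 0 * t, μ⁻¹ ^ n * μ⁻¹ ^ n * (l₁ y 1 0 * t)] 0 =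
      l₂ y 0 0 * F.toEquiv ![t, 0] 0 := by
    intro n
    have : ν ^ n * ν⁻¹ ^ n = 1 := by rw [← mul_pow, mul_inv_cancel₀ hν0, one_pow]
    rw [← e, F.map_smul]
    rw [map_mul, map_mul, mul_smul, mul_smul]
    simp only [gl_smul_apply, map_pow_diagonal h₂,
      map_inv_pow_diagonal hν0 h₂, F.map_axis hμ hν h₁ h₂ ht]
    simp only [Matrix.of_apply, Matrix.cons_val]
    linear_combination l₂ y 0 0 * F.toEquiv ![t, 0] 0 * this
  have hlim : Tendsto (fun n : ℕ => μ⁻¹ ^ n * μ⁻¹ ^ n * (l₁ y 1 0 * t)) atTop (𝓝 0) := by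
    simpa using ((tendsto_inv_pow hμ).mul (tendsto_inv_pow hμ)).mul_const (l₁ y 1 0 * t)
  have t1 := F.tendsto_apply (vec_ne_zero_left (mul_ne_zero hy ht))
    (tendsto_vec (tendsto_const_nhds (x := l₁ y 0 0 * t)) hlim) 0
  refine tendsto_nhds_unique t1 (tendsto_const_nhds.congr fun n => (e' n).symm)

end Diagonal

end

/-! ### Rigidity when `x₀` is diagonal in both representations -/

section

variable {Γ : Type*} [Group Γ] {l₁ l₂ : Γ →* GL (Fin 2) ℝ} {x₀ : Γ} {μ ν : ℝ}

/-- The map induced by `F` on the expanding axis, normalized by `1 ↦ 1`. -/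
noncomputable def PlaneConj.axisMap (F : PlaneConj l₁ l₂) (t : ℝ) : ℝ :=
  F.toEquiv ![t, 0] 0 / F.toEquiv ![1, 0] 0

/-- `l₁` and `l₂` map `x₀` to diagonal matrices of determinant one, expanding on the first axis. -/
structure IsDiagonalPair (l₁ l₂ : Γ →* GL (Fin 2) ℝ) (x₀ : Γ) (μ ν : ℝ) : Prop where
  one_lt_left : 1 < |μ|
  one_lt_right : 1 < |ν|
  map_left : (l₁ x₀ : Matrix (Fin 2) (Fin 2) ℝ) = !![μ, 0; 0, μ⁻¹]
  map_right : (l₂ x₀ : Matrix (Fin 2) (Fin 2) ℝ) = !![ν, 0; 0, ν⁻¹]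

namespace IsDiagonalPair

theorem left_ne_zero (D : IsDiagonalPair l₁ l₂ x₀ μ ν) : μ ≠ 0 := by
  rintro rfl
  have := D.one_lt_left
  norm_num at this

theorem right_ne_zero (D : IsDiagonalPair l₁ l₂ x₀ μ ν) : ν ≠ 0 := by
  rintro rfl
  have := D.one_lt_right
  norm_num at this

theorem map_axis (D : IsDiagonalPair l₁ l₂ x₀ μ ν) (F : PlaneConj l₁ l₂) {t : ℝ} (ht : t ≠ 0) :
    F.toEquiv ![t, 0] 1 = 0 :=
  F.map_axis D.one_lt_left D.one_lt_right D.map_left D.map_right ht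

theorem apply_axis_ne_zero (D : IsDiagonalPair l₁ l₂ x₀ μ ν) (F : PlaneConj l₁ l₂) {t : ℝ}
    (ht : t ≠ 0) : F.toEquiv ![t, 0] 0 ≠ 0 := by
  intro h
  apply F.map_ne_zero (vec_ne_zero_left (b := 0) ht)
  ext i
  fin_cases i
  · exact h
  · exact D.map_axis F ht

theorem axisMap_one (D : IsDiagonalPair l₁ l₂ x₀ μ ν) (F : PlaneConj l₁ l₂) : F.axisMap 1 = 1 :=
  div_self (D.apply_axis_ne_zero F one_ne_zero)

theorem axisMap_ne_zero (D : IsDiagonalPair l₁ l₂ x₀ μ ν) (F : PlaneConj l₁ l₂) {t : ℝ}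
    (ht : t ≠ 0) : F.axisMap t ≠ 0 :=
  div_ne_zero (D.apply_axis_ne_zero F ht) (D.apply_axis_ne_zero F one_ne_zero)

/-- Injectivity of `F`; needed to settle the sign for negative entries. -/
theorem axisMap_neg_one_ne (D : IsDiagonalPair l₁ l₂ x₀ μ ν) (F : PlaneConj l₁ l₂) :
    F.axisMap (-1) ≠ 1 := by
  intro h
  rw [PlaneConj.axisMap, div_eq_one_iff_eq (D.apply_axis_ne_zero F one_ne_zero)] at h
  have h' : F.toEquiv ![-1, 0] = F.toEquiv ![1, 0] := by
    ext i
    fin_cases i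
    · exact h
    · exact (D.map_axis F (neg_ne_zero.2 one_ne_zero)).trans (D.map_axis F one_ne_zero).symm
  have := congrFun (F.toEquiv.injective h') 0
  norm_num at this

theorem axisMap_continuousAt (F : PlaneConj l₁ l₂) {t : ℝ} (ht : t ≠ 0) :
    ContinuousAt F.axisMap t := by
  have h1 : Continuous fun t : ℝ => (![t, 0] : Fin 2 → ℝ) := by
    refine continuous_pi fun i => ?_
    fin_cases i
    · exact continuous_id
    · exact continuous_const
  have h2 : ContinuousAt (fun t : ℝ => F.toEquiv ![t, 0]) t :=
    ContinuousAt.comp (f := fun t : ℝ => (![t, 0] : Fin 2 → ℝ))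
      (F.continuousAt _ (vec_ne_zero_left ht)) h1.continuousAt
  exact ((continuous_apply 0).continuousAt.comp h2).div_const _

theorem axisMap_entry (D : IsDiagonalPair l₁ l₂ x₀ μ ν) (F : PlaneConj l₁ l₂) {y : Γ}
    (hy : l₁ y 0 0 ≠ 0) : F.axisMap (l₁ y 0 0) = l₂ y 0 0 ∧ IsMultiplier F.axisMap (l₁ y 0 0) := by
  have key : ∀ t, t ≠ 0 → F.axisMap (l₁ y 0 0 * t) = l₂ y 0 0 * F.axisMap t := by
    intro t ht
    rw [PlaneConj.axisMap, F.map_axis_mul D.one_lt_left D.one_lt_right D.map_left D.map_right ht y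
      hy, mul_div_assoc, ← PlaneConj.axisMap]
  have h1 : F.axisMap (l₁ y 0 0) = l₂ y 0 0 := by
    have := key 1 one_ne_zero
    rwa [mul_one, D.axisMap_one, mul_one] at this
  refine ⟨h1, hy, fun t ht => ?_⟩
  rw [key t ht, h1]

theorem entry_ne_zero (D : IsDiagonalPair l₁ l₂ x₀ μ ν) (F : PlaneConj l₁ l₂) {y : Γ}
    (hy : l₁ y 0 0 ≠ 0) : l₂ y 0 0 ≠ 0 := by
  rw [← (D.axisMap_entry F hy).1]
  exact D.axisMap_ne_zero F hy

theorem map_mul_pow_mul {l : Γ →* GL (Fin 2) ℝ} {r : ℝ}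
    (h : (l x₀ : Matrix (Fin 2) (Fin 2) ℝ) = !![r, 0; 0, r⁻¹]) (y z : Γ) (n : ℕ) (i j : Fin 2) :
    l (y * x₀ ^ n * z) i j = l y i 0 * l z 0 j * r ^ n + l y i 1 * l z 1 j * r⁻¹ ^ n := by
  rw [map_mul_apply l (y * x₀ ^ n), map_mul_apply l y, map_mul_apply l y, map_pow_diagonal h]
  simp
  ring

theorem map_mul_pow_mul_eq {l : Γ →* GL (Fin 2) ℝ} {r : ℝ} (hr : r ≠ 0)
    (h : (l x₀ : Matrix (Fin 2) (Fin 2) ℝ) = !![r, 0; 0, r⁻¹]) {y z : Γ} (hy : l y 0 0 ≠ 0)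
    (hz : l z 0 0 ≠ 0) (n : ℕ) :
    l (y * x₀ ^ n * z) 0 0 = l y 0 0 * l z 0 0 * r ^ n *
      (1 + l y 0 1 * l z 1 0 / (l y 0 0 * l z 0 0) * (r⁻¹ ^ 2) ^ n) := by
  rw [map_mul_pow_mul h, ← pow_mul, mul_comm 2 n, pow_mul, inv_pow]
  have := pow_ne_zero n hr
  field_simp

theorem inv_sq_pos {r : ℝ} (hr : r ≠ 0) : 0 < r⁻¹ ^ 2 := by positivity

theorem inv_sq_lt_one {r : ℝ} (hr : 1 < |r|) : r⁻¹ ^ 2 < 1 := by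
  rw [sq_lt_one_iff_abs_lt_one, abs_inv]
  exact inv_lt_one_of_one_lt₀ hr

theorem eventually_ne_zero {r x : ℝ} (hr : 1 < |r|) :
    ∀ᶠ n : ℕ in atTop, 1 + x * (r⁻¹ ^ 2) ^ n ≠ 0 := by
  have hr0 : r ≠ 0 := by rintro rfl; norm_num at hr
  exact (tendsto_one_add_mul_pow (inv_sq_pos hr0) (inv_sq_lt_one hr)).eventually_ne one_ne_zero

/-- The argument is the upper left entry of `y * x₀ ^ n * z` divided by those of `y`, `z` and `x₀ ^
n`, thus a quotient of multipliers with known values; large `n` keeps it nonzero. -/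
theorem eventually_axisMap (D : IsDiagonalPair l₁ l₂ x₀ μ ν) (F : PlaneConj l₁ l₂) {y z : Γ}
    (hy : l₁ y 0 0 ≠ 0) (hz : l₁ z 0 0 ≠ 0) : ∀ᶠ n : ℕ in atTop,
    F.axisMap (1 + l₁ y 0 1 * l₁ z 1 0 / (l₁ y 0 0 * l₁ z 0 0) * (μ⁻¹ ^ 2) ^ n) =
      1 + l₂ y 0 1 * l₂ z 1 0 / (l₂ y 0 0 * l₂ z 0 0) * (ν⁻¹ ^ 2) ^ n ∧
    IsMultiplier F.axisMap
      (1 + l₁ y 0 1 * l₁ z 1 0 / (l₁ y 0 0 * l₁ z 0 0) * (μ⁻¹ ^ 2) ^ n) := by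
  filter_upwards [eventually_ne_zero D.one_lt_left
    (x := l₁ y 0 1 * l₁ z 1 0 / (l₁ y 0 0 * l₁ z 0 0))] with n hn
  have e₁ := map_mul_pow_mul_eq D.left_ne_zero D.map_left hy hz n
  have e₂ := map_mul_pow_mul_eq D.right_ne_zero D.map_right (D.entry_ne_zero F hy)
    (D.entry_ne_zero F hz) n
  have hxn : l₁ (x₀ ^ n) 0 0 = μ ^ n := by rw [map_pow_diagonal D.map_left]; simp
  have hxn' : l₂ (x₀ ^ n) 0 0 = ν ^ n := by rw [map_pow_diagonal D.map_right]; simp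
  have hμn := pow_ne_zero n D.left_ne_zero
  have hνn := pow_ne_zero n D.right_ne_zero
  obtain ⟨ψw, mw⟩ := D.axisMap_entry F (y := y * x₀ ^ n * z) (by rw [e₁]; positivity)
  obtain ⟨ψy, my⟩ := D.axisMap_entry F hy
  obtain ⟨ψz, mz⟩ := D.axisMap_entry F hz
  obtain ⟨ψx, mx⟩ := D.axisMap_entry F (y := x₀ ^ n) (by rwa [hxn])
  rw [hxn, hxn'] at ψx
  rw [hxn] at mx
  have m := (my.mul mz).mul mx
  have e : 1 + l₁ y 0 1 * l₁ z 1 0 / (l₁ y 0 0 * l₁ z 0 0) * (μ⁻¹ ^ 2) ^ n =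
      l₁ (y * x₀ ^ n * z) 0 0 / (l₁ y 0 0 * l₁ z 0 0 * μ ^ n) := by
    rw [e₁, mul_div_cancel_left₀ _ (by positivity)]
  rw [e]
  constructor
  · have hy' := D.entry_ne_zero F hy
    have hz' := D.entry_ne_zero F hz
    rw [mw.map_div (D.axisMap_one F) m, ψw, (my.mul mz).2 _ hμn, my.2 _ hz, ψy, ψz, ψx, e₂,
      mul_div_cancel_left₀ _ (by positivity)]
  · rw [div_eq_mul_inv]
    exact mw.mul (m.inv (D.axisMap_one F))

theorem axisMap_eq_self (D : IsDiagonalPair l₁ l₂ x₀ μ ν) (F : PlaneConj l₁ l₂) {y : Γ}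
    (ha : l₁ y 0 0 ≠ 0) (hb : l₁ y 0 1 ≠ 0) (hc : l₁ y 1 0 ≠ 0) :
    ∀ s, 0 < s → IsMultiplier F.axisMap s ∧ F.axisMap s = s := by
  have hx : l₁ y 0 1 * l₁ y 1 0 / (l₁ y 0 0 * l₁ y 0 0) ≠ 0 := by positivity
  have hev := D.eventually_axisMap F ha ha
  have hε0 := inv_sq_pos D.left_ne_zero
  have hε1 := inv_sq_lt_one D.one_lt_left
  have hmul : ∀ s, 0 < s → IsMultiplier F.axisMap s := fun s hs =>
    isMultiplier_of_pos (D.axisMap_one F) (fun t ht => axisMap_continuousAt F ht) hx hε0 hε1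
      (hev.mono fun n hn => hn.2) hs
  obtain ⟨α, hα⟩ := exists_eq_rpow (fun t ht => axisMap_continuousAt F ht)
    (fun t ht => D.axisMap_ne_zero F ht) hmul
  have hα1 : α = 1 := by
    refine rpow_exponent_eq_one hx hε0 hε1 (inv_sq_lt_one D.one_lt_right) ?_ ?_
      (y := l₂ y 0 1 * l₂ y 1 0 / (l₂ y 0 0 * l₂ y 0 0))
    -- The entries of `x₀` itself give `ψ μ = ν`, hence `ψ (μ⁻²) = ν⁻²`.
    · have hx0 : l₁ x₀ 0 0 = μ := by rw [D.map_left]; simp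
      have hx0' : l₂ x₀ 0 0 = ν := by rw [D.map_right]; simp
      obtain ⟨h1, h2⟩ := D.axisMap_entry F (y := x₀) (by rw [hx0]; exact D.left_ne_zero)
      rw [hx0, hx0'] at h1
      rw [hx0] at h2
      have h3 := h2.map_inv (D.axisMap_one F)
      rw [h1] at h3
      rw [← hα _ hε0, sq, (h2.inv (D.axisMap_one F)).2 _ (inv_ne_zero D.left_ne_zero),
        eq_inv_of_mul_eq_one_right h3, sq]
    · filter_upwards [hev, (tendsto_one_add_mul_pow hε0 hε1).eventually_const_lt one_pos]
        with n hn hn'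
      rw [← hα _ hn', hn.1]
  intro s hs
  refine ⟨hmul s hs, ?_⟩
  rw [hα s hs, hα1, Real.rpow_one]

/-- A negative entry makes `-1` a multiplier, so `ψ (-1) = ±1`, and injectivity leaves only `-1`. -/
theorem entry_eq (D : IsDiagonalPair l₁ l₂ x₀ μ ν) (F : PlaneConj l₁ l₂) {y : Γ}
    (h : ∀ s, 0 < s → IsMultiplier F.axisMap s ∧ F.axisMap s = s) (hy : l₁ y 0 0 ≠ 0) :
    l₂ y 0 0 = l₁ y 0 0 := by
  obtain ⟨h1, h2⟩ := D.axisMap_entry F hy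
  rcases hy.lt_or_gt with hneg | hpos
  · have hp : 0 < -l₁ y 0 0 := by linarith
    obtain ⟨h3, h4⟩ := h _ hp
    have e : l₁ y 0 0 / -l₁ y 0 0 = -1 := by rw [div_neg, div_self hy]
    have m : IsMultiplier F.axisMap (-1) := by
      rw [← e, div_eq_mul_inv]
      exact h2.mul (h3.inv (D.axisMap_one F))
    have h5 := h2.map_div (D.axisMap_one F) h3
    have h6 := m.2 (-1) (by norm_num)
    rw [neg_mul_neg, one_mul, D.axisMap_one] at h6
    have h7 : F.axisMap (-1) = -1 := by
      rcases mul_self_eq_one_iff.1 h6.symm with h | h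
      · exact absurd h (D.axisMap_neg_one_ne F)
      · exact h
    rw [e, h7, h4, h1, eq_div_iff hp.ne'] at h5
    linarith
  · rw [← h1, (h _ hpos).2]

/-- Rigidity in a basis in which `x₀` is diagonal. -/
theorem conjugateReps (D : IsDiagonalPair l₁ l₂ x₀ μ ν) (F : PlaneConj l₁ l₂) {y : Γ}
    (ha : l₁ y 0 0 ≠ 0) (hb : l₁ y 0 1 ≠ 0) (hc : l₁ y 1 0 ≠ 0) : ConjugateReps l₁ l₂ := by
  have hid := D.axisMap_eq_self F ha hb hc
  have hentry : ∀ z, l₁ z 0 0 ≠ 0 → l₂ z 0 0 = l₁ z 0 0 := fun z hz => D.entry_eq F hid hz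
  have hμν : ν = μ := by
    have hx0 : l₁ x₀ 0 0 = μ := by rw [D.map_left]; simp
    have hx0' : l₂ x₀ 0 0 = ν := by rw [D.map_right]; simp
    have := hentry x₀ (by rw [hx0]; exact D.left_ne_zero)
    rwa [hx0, hx0'] at this
  -- Since `ψ` is the identity on positive numbers, the coefficients of `μ⁻²ⁿ` in the upper left
  -- entries of `z x₀ⁿ w` can be compared.
  have hprod : ∀ z w, l₁ z 0 0 ≠ 0 → l₁ w 0 0 ≠ 0 →
      l₂ z 0 1 * l₂ w 1 0 = l₁ z 0 1 * l₁ w 1 0 := by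
    intro z w hz hw
    obtain ⟨n, hn, hn'⟩ := ((D.eventually_axisMap F hz hw).and
      ((tendsto_one_add_mul_pow (inv_sq_pos D.left_ne_zero)
        (inv_sq_lt_one D.one_lt_left)).eventually_const_lt one_pos)).exists
    have e := hn.1
    rw [(hid _ hn').2, hentry z hz, hentry w hw, hμν] at e
    have h1 := mul_right_cancel₀ (pow_ne_zero n (inv_sq_pos D.left_ne_zero).ne')
      (add_left_cancel e)
    exact ((div_left_inj' (mul_ne_zero hz hw)).1 h1).symm
  have hyy := hprod y y ha ha
  have hb' : l₂ y 0 1 ≠ 0 := left_ne_zero_of_mul (hyy ▸ mul_ne_zero hb hc)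
  have hc' : l₂ y 1 0 ≠ 0 := right_ne_zero_of_mul (hyy ▸ mul_ne_zero hb hc)
  set k := l₂ y 0 1 / l₁ y 0 1 with hk
  have hk0 : k ≠ 0 := div_ne_zero hb' hb
  have hkb : l₂ y 0 1 = k * l₁ y 0 1 := by rw [hk]; field_simp
  have hB : ∀ z, l₁ z 0 0 ≠ 0 → l₂ z 0 1 = k * l₁ z 0 1 := by
    intro z hz
    apply mul_right_cancel₀ hc'
    have h1 := hprod z y hz ha
    rw [hkb] at hyy
    have h2 : k * l₂ y 1 0 = l₁ y 1 0 := by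
      apply mul_left_cancel₀ hb
      linarith
    rw [h1, ← h2]
    ring
  have hC : ∀ z, l₁ z 0 0 ≠ 0 → k * l₂ z 1 0 = l₁ z 1 0 := by
    intro z hz
    have h1 := hprod y z ha hz
    rw [hkb] at h1
    apply mul_left_cancel₀ hb
    linarith
  have hD : ∀ z, l₁ z 0 0 ≠ 0 → l₂ z 1 1 = l₁ z 1 1 := by
    intro z hz
    obtain ⟨n, hn⟩ := (eventually_ne_zero D.one_lt_left
      (x := l₁ y 0 1 * l₁ z 1 0 / (l₁ y 0 0 * l₁ z 0 0))).exists
    -- The upper right entry of this product contains the lower right entry of `z` with nonzero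
    -- coefficient `l₁ y 0 1 * μ⁻¹ ^ n`, so `hB` determines it.
    have hw : l₁ (y * x₀ ^ n * z) 0 0 ≠ 0 := by
      rw [map_mul_pow_mul_eq D.left_ne_zero D.map_left ha hz]
      have := pow_ne_zero n D.left_ne_zero
      positivity
    have h1 := hB _ hw
    rw [map_mul_pow_mul D.map_left, map_mul_pow_mul D.map_right, hμν, hentry y ha, hB z hz,
      hkb] at h1
    have h2 : k * l₁ y 0 1 * μ⁻¹ ^ n ≠ 0 :=
      mul_ne_zero (mul_ne_zero hk0 hb) (pow_ne_zero n (inv_ne_zero D.left_ne_zero))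
    apply mul_left_cancel₀ h2
    linear_combination h1
  let h : GL (Fin 2) ℝ := Matrix.GeneralLinearGroup.mkOfDetNeZero !![k, 0; 0, 1]
    (by simpa [Matrix.det_fin_two] using hk0)
  have hh : (h : Matrix (Fin 2) (Fin 2) ℝ) = !![k, 0; 0, 1] := rfl
  have main : ∀ z, l₁ z 0 0 ≠ 0 → l₂ z = h * l₁ z * h⁻¹ := by
    intro z hz
    rw [eq_mul_inv_iff_mul_eq]
    ext i j
    rw [Units.val_mul, Units.val_mul, hh, Matrix.mul_apply, Matrix.mul_apply]
    fin_cases i <;> fin_cases j <;>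
      simp [Fin.sum_univ_two, hentry z hz, hB z hz, hD z hz, ← hC z hz, mul_comm]
  refine ⟨h, fun z => ?_⟩
  by_cases hz : l₁ z 0 0 = 0
  · have hd := det_ne_zero (l₁ z)
    have hzb : l₁ z 0 1 ≠ 0 := by
      intro h0
      simp [hz, h0] at hd
    -- Multiplying by `y` makes the upper left entry nonzero.
    have h1 := main (z * y) (by
      rw [map_mul_apply, hz, zero_mul, zero_add]
      exact mul_ne_zero hzb hc)
    rw [map_mul, map_mul, main y ha] at h1
    have h2 : l₂ z = (h * (l₁ z * l₁ y) * h⁻¹) * (h * l₁ y * h⁻¹)⁻¹ := by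
      rw [← h1, mul_inv_cancel_right]
    rw [h2]
    group
  · exact main z hz

end IsDiagonalPair

end

/-! ### Hyperbolicity is preserved, and linear rigidity -/

section

variable {Γ : Type*} [Group Γ] {l₁ l₂ : Γ →* GL (Fin 2) ℝ} {μ : ℝ}

/-- Trace `±2` gives an eigenvalue `±1`, so `l₂ (x ^ 2)` fixes a nonzero vector, while `diag (μ²,
μ⁻²)` fixes none. -/
theorem PlaneConj.trace_sq_ne_four (F : PlaneConj l₁ l₂) {x : Γ} (hμ : 1 < |μ|)
    (h₁ : (l₁ x : Matrix (Fin 2) (Fin 2) ℝ) = !![μ, 0; 0, μ⁻¹])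
    (hdet : l₂ x 0 0 * l₂ x 1 1 - l₂ x 0 1 * l₂ x 1 0 = 1) :
    (l₂ x 0 0 + l₂ x 1 1) ^ 2 ≠ 4 := by
  intro ht
  obtain ⟨u, hu, u0, u1⟩ := exists_eigenvector hdet (s := (l₂ x 0 0 + l₂ x 1 1) / 2)
    (by linear_combination - ht / 4)
  have hxu : l₂ x • u = ((l₂ x 0 0 + l₂ x 1 1) / 2) • u := by
    ext i
    rw [gl_smul_apply]
    fin_cases i
    · exact u0
    · exact u1
  have hfix : l₂ (x ^ 2) • u = u := by
    rw [pow_two, map_mul, mul_smul, hxu, smul_comm, hxu, smul_smul]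
    convert one_smul ℝ u using 2
    linear_combination ht / 4
  have hp : l₁ (x ^ 2) • F.toEquiv.symm u = F.toEquiv.symm u := by
    apply F.toEquiv.injective
    rw [F.map_smul, F.toEquiv.apply_symm_apply, hfix]
  have hμ2 : 1 < μ ^ 2 := by rwa [one_lt_sq_iff_one_lt_abs]
  have hμ2' : μ⁻¹ ^ 2 < 1 := IsDiagonalPair.inv_sq_lt_one hμ
  apply F.symm_ne_zero hu
  ext i
  have hi := congrFun hp i
  rw [gl_smul_apply, map_pow_diagonal h₁] at hi
  fin_cases i
  · simp only [Fin.zero_eta, Matrix.of_apply, Matrix.cons_val] at hi ⊢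
    apply mul_left_cancel₀ (sub_pos.2 hμ2).ne'
    simp only [Pi.zero_apply]
    linear_combination hi
  · simp only [Fin.mk_one, Matrix.of_apply, Matrix.cons_val] at hi ⊢
    apply mul_left_cancel₀ (sub_pos.2 hμ2').ne'
    simp only [Pi.zero_apply]
    linear_combination - hi

/-- The quadratic form preserved by a matrix of determinant one. -/
def invariantForm (g : GL (Fin 2) ℝ) (p : Fin 2 → ℝ) : ℝ :=
  g 1 0 * p 0 ^ 2 + (g 1 1 - g 0 0) * (p 0 * p 1) - g 0 1 * p 1 ^ 2

theorem invariantForm_smul {g : GL (Fin 2) ℝ} (hdet : g 0 0 * g 1 1 - g 0 1 * g 1 0 = 1)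
    (p : Fin 2 → ℝ) : invariantForm g (g • p) = invariantForm g p := by
  simp only [invariantForm, gl_smul_apply]
  linear_combination (g 1 0 * p 0 ^ 2 + (g 1 1 - g 0 0) * (p 0 * p 1) - g 0 1 * p 1 ^ 2) * hdet

/-- An elliptic `l₂ x` preserves a definite form, so the points `F (μ⁻ⁿ, 0)` stay on an ellipse and
accumulate at some `q ≠ 0`. Continuity of the inverse at `q` contradicts `(μ⁻ⁿ, 0) → 0`. -/
theorem PlaneConj.four_le_trace_sq (F : PlaneConj l₁ l₂) {x : Γ} (hμ : 1 < |μ|)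
    (h₁ : (l₁ x : Matrix (Fin 2) (Fin 2) ℝ) = !![μ, 0; 0, μ⁻¹])
    (hdet : l₂ x 0 0 * l₂ x 1 1 - l₂ x 0 1 * l₂ x 1 0 = 1) :
    4 ≤ (l₂ x 0 0 + l₂ x 1 1) ^ 2 := by
  by_contra! ht
  have hμ0 : μ ≠ 0 := by rintro rfl; norm_num at hμ
  have ht' : 0 < 4 - (l₂ x 0 0 + l₂ x 1 1) ^ 2 := by linarith
  set τ := 4 - (l₂ x 0 0 + l₂ x 1 1) ^ 2 with hτ
  have hQ0 : ∀ p, p 0 ^ 2 * τ ≤ -4 * l₂ x 0 1 * invariantForm (l₂ x) p := by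
    intro p
    have : -4 * l₂ x 0 1 * invariantForm (l₂ x) p - p 0 ^ 2 * τ =
        (2 * l₂ x 0 1 * p 1 - (l₂ x 1 1 - l₂ x 0 0) * p 0) ^ 2 := by
      rw [hτ, invariantForm]
      linear_combination 4 * p 0 ^ 2 * hdet
    nlinarith [sq_nonneg (2 * l₂ x 0 1 * p 1 - (l₂ x 1 1 - l₂ x 0 0) * p 0)]
  have hQ1 : ∀ p, p 1 ^ 2 * τ ≤ 4 * l₂ x 1 0 * invariantForm (l₂ x) p := by
    intro p
    have : 4 * l₂ x 1 0 * invariantForm (l₂ x) p - p 1 ^ 2 * τ =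
        (2 * l₂ x 1 0 * p 0 + (l₂ x 1 1 - l₂ x 0 0) * p 1) ^ 2 := by
      rw [hτ, invariantForm]
      linear_combination 4 * p 1 ^ 2 * hdet
    nlinarith [sq_nonneg (2 * l₂ x 1 0 * p 0 + (l₂ x 1 1 - l₂ x 0 0) * p 1)]
  set u : ℕ → Fin 2 → ℝ := fun n => F.toEquiv ![μ⁻¹ ^ n, 0] with hu
  have hstep : ∀ n, l₂ x • u (n + 1) = u n := by
    intro n
    rw [hu]
    simp only
    rw [← F.map_smul]
    congr 1
    ext i
    rw [gl_smul_apply, h₁]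
    fin_cases i
    · simp [pow_succ]
      field_simp
    · simp
  have hQu : ∀ n, invariantForm (l₂ x) (u n) = invariantForm (l₂ x) (u 0) := by
    intro n
    induction n with
    | zero => rfl
    | succ n ih => rw [← ih, ← hstep n, invariantForm_smul hdet]
  obtain ⟨R, hR⟩ : ∃ R : ℝ, ∀ n i, |u n i| ≤ R := by
    set q := invariantForm (l₂ x) (u 0)
    refine ⟨max √(-4 * l₂ x 0 1 * q / τ) √(4 * l₂ x 1 0 * q / τ), fun n i => ?_⟩
    fin_cases i
    · refine le_max_of_le_left (Real.abs_le_sqrt ?_)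
      rw [le_div_iff₀ ht', ← hQu n]
      exact hQ0 (u n)
    · refine le_max_of_le_right (Real.abs_le_sqrt ?_)
      rw [le_div_iff₀ ht', ← hQu n]
      exact hQ1 (u n)
  obtain ⟨q, -, φ, hφ, hlim⟩ := (isCompact_Icc (a := fun _ : Fin 2 => -R)
    (b := fun _ => R)).tendsto_subseq (x := u) fun n =>
      ⟨fun i => (abs_le.1 (hR n i)).1, fun i => (abs_le.1 (hR n i)).2⟩
  have hcont : Continuous (invariantForm (l₂ x)) := by
    unfold invariantForm
    fun_prop
  have hQq : invariantForm (l₂ x) q = invariantForm (l₂ x) (u 0) :=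
    tendsto_nhds_unique ((hcont.tendsto q).comp hlim)
      (tendsto_const_nhds.congr fun n => (hQu (φ n)).symm)
  have hq : q ≠ 0 := by
    rintro rfl
    have hz : invariantForm (l₂ x) (u 0) = 0 := by rw [← hQq]; simp [invariantForm]
    apply F.map_ne_zero (vec_ne_zero_left (a := μ⁻¹ ^ 0) (b := 0) (by simp))
    change u 0 = 0
    have h0 := hQ0 (u 0)
    have h1 := hQ1 (u 0)
    rw [hz, mul_zero] at h0 h1
    have h0' : u 0 0 ^ 2 = 0 := le_antisymm (nonpos_of_mul_nonpos_left h0 ht') (sq_nonneg _)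
    have h1' : u 0 1 ^ 2 = 0 := le_antisymm (nonpos_of_mul_nonpos_left h1 ht') (sq_nonneg _)
    ext i
    fin_cases i
    · exact pow_eq_zero_iff two_ne_zero |>.1 h0'
    · exact pow_eq_zero_iff two_ne_zero |>.1 h1'
  have t1 := (F.continuousAt_symm q hq).tendsto.comp hlim
  have t2 : Tendsto (fun n => ![μ⁻¹ ^ φ n, 0]) atTop (𝓝 (![0, 0] : Fin 2 → ℝ)) :=
    tendsto_vec ((tendsto_inv_pow hμ).comp hφ.tendsto_atTop) tendsto_const_nhds
  apply F.symm_ne_zero hq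
  have := tendsto_nhds_unique t1 (t2.congr fun n => by simp [u])
  rw [this]
  ext i
  fin_cases i <;> simp

/-- Topologically conjugate linear actions on `ℝ² ∖ {0}` of a group that is not solvable, one of
them faithful, are linearly conjugate. -/
theorem PlaneConj.conjugateReps (F : PlaneConj l₁ l₂) (hl : Function.Injective l₁)
    (hΓ : ¬ Group.IsSolvable Γ) : ConjugateReps l₁ l₂ := by
  have hdet : ∀ (l : Γ →* GL (Fin 2) ℝ) (x : commutator Γ),
      l x 0 0 * l x 1 1 - l x 0 1 * l x 1 0 = 1 := by
    intro l x
    have h := Abelianization.commutator_subset_ker (Matrix.GeneralLinearGroup.det.comp l) x.2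
    rw [MonoidHom.mem_ker] at h
    rw [← Matrix.det_fin_two]
    exact congrArg Units.val h
  obtain ⟨x, hx⟩ := exists_hyperbolic (l := l₁.comp (commutator Γ).subtype)
    (hl.comp Subtype.val_injective) (fun x => hdet l₁ x)
    (fun h => hΓ (isSolvable_of_isSolvable_commutator h))
  obtain ⟨P, μ, hμ, hP⟩ := exists_conj_diagonal (l₁ x) (hdet l₁ x) hx
  have ht : 4 < (l₂ x 0 0 + l₂ x 1 1) ^ 2 := by
    -- Only the source is diagonalized; the normal form of `l₂ x` is not yet known to exist.
    have F' := F.conj P 1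
    have e : conjRep 1 l₂ = l₂ := by
      ext1 y
      rw [conjRep_apply, one_mul, inv_one, mul_one]
    rw [e] at F'
    exact lt_of_le_of_ne (F'.four_le_trace_sq hμ hP (hdet l₂ x))
      (F'.trace_sq_ne_four hμ hP (hdet l₂ x)).symm
  obtain ⟨Q, ν, hν, hQ⟩ := exists_conj_diagonal (l₂ x) (hdet l₂ x) ht
  have D : IsDiagonalPair (conjRep P l₁) (conjRep Q l₂) (x : Γ) μ ν := ⟨hμ, hν, hP, hQ⟩
  obtain ⟨y, ha, hb, hc⟩ := exists_entries_ne_zero (conjRep_injective P hl) hΓ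
  obtain ⟨h, hh⟩ := D.conjugateReps (F.conj P Q) ha hb hc
  refine ⟨Q⁻¹ * h * P, fun z => ?_⟩
  have := hh z
  rw [conjRep_apply, conjRep_apply] at this
  have e : l₂ z = Q⁻¹ * (Q * l₂ z * Q⁻¹) * Q := by group
  rw [e, this]
  group

/-! ### The annulus as the punctured plane -/

section Annulus

theorem mk_mem_annulus {v : V} (hv : v ≠ 0) :
    Projectivization.mk ℝ v hv ∈ annulus ↔ v 1 ≠ 0 ∧ ¬ (v 0 = 0 ∧ v 2 = 0) := by
  have h : v 1 ≠ 0 → (Projectivization.mk ℝ v hv = ptE2 ↔ v 0 = 0 ∧ v 2 = 0) := by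
    intro h1
    rw [ptE2, Projectivization.mk_eq_mk_iff']
    constructor
    · rintro ⟨a, rfl⟩
      simp
    · rintro ⟨h0, h2⟩
      refine ⟨v 1, ?_⟩
      ext i
      fin_cases i <;> simp [h0, h2]
  rw [annulus, Set.mem_compl_iff, Set.mem_union, mk_mem_lineL0, Set.mem_singleton_iff]
  tauto

/-- The affine coordinates `(v₀ / v₁, v₂ / v₁)` on `P(V) ∖ L₀`. -/
noncomputable def affineCoord : ℙ ℝ V → Fin 2 → ℝ :=
  Projectivization.lift (fun v => ![v.1 0 / v.1 1, v.1 2 / v.1 1]) (by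
    rintro ⟨v, hv⟩ ⟨w, hw⟩ t h
    have ht : t ≠ 0 := by
      rintro rfl
      exact hv (by simpa using h)
    simp only at h
    subst h
    simp [mul_div_mul_left _ _ ht])

theorem affineCoord_mk {v : V} (hv : v ≠ 0) :
    affineCoord (Projectivization.mk ℝ v hv) = ![v 0 / v 1, v 2 / v 1] := rfl

theorem isQuotientMap_mk' :
    IsQuotientMap (Projectivization.mk' ℝ : {v : V // v ≠ 0} → ℙ ℝ V) :=
  ⟨⟨rfl⟩, Quotient.mk_surjective⟩

theorem continuous_coord (i : Fin 3) : Continuous fun v : {v : V // v ≠ 0} => v.1 i :=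
  (continuous_apply i).comp continuous_subtype_val

theorem continuousOn_affineCoord : ContinuousOn affineCoord annulus := by
  have ho : IsOpen (lineL0ᶜ) := by
    rw [← isQuotientMap_mk'.isOpen_preimage]
    have : Projectivization.mk' ℝ ⁻¹' lineL0ᶜ = {v : {v : V // v ≠ 0} | v.1 1 ≠ 0} := by
      ext v
      exact not_congr (mk_mem_lineL0 v.2)
    rw [this]
    exact isOpen_ne_fun (continuous_coord 1) continuous_const
  refine ContinuousOn.mono ?_ (Set.compl_subset_compl.2 Set.subset_union_left)
  rw [isQuotientMap_mk'.continuousOn_isOpen_iff ho]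
  change ContinuousOn (fun v : {v : V // v ≠ 0} => ![v.1 0 / v.1 1, v.1 2 / v.1 1]) _
  have hne : ∀ v ∈ Projectivization.mk' ℝ ⁻¹' lineL0ᶜ, (v : V) 1 ≠ 0 := fun v hv =>
    fun h => hv ((mk_mem_lineL0 v.2).2 h)
  refine continuousOn_pi.2 fun i => ?_
  fin_cases i
  · exact ContinuousOn.div (continuous_coord 0).continuousOn (continuous_coord 1).continuousOn hne
  · exact ContinuousOn.div (continuous_coord 2).continuousOn (continuous_coord 1).continuousOn hne

theorem affineCoord_ne_zero {p : ℙ ℝ V} (hp : p ∈ annulus) : affineCoord p ≠ 0 := by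
  induction p with
  | h v hv =>
    obtain ⟨h1, h2⟩ := (mk_mem_annulus hv).1 hp
    intro h
    rw [affineCoord_mk] at h
    have e0 := congrFun h 0
    have e1 := congrFun h 1
    simp [h1] at e0 e1
    exact h2 ⟨e0, e1⟩

/-- The annulus is the punctured plane. -/
noncomputable def annulusHomeomorph : annulus ≃ₜ {p : Fin 2 → ℝ // p ≠ 0} where
  toFun p := ⟨affineCoord p, affineCoord_ne_zero p.2⟩
  invFun p := ⟨Projectivization.mk ℝ ![p.1 0, 1, p.1 1] (fun h => by
      simpa using congrFun h 1), by
    rw [mk_mem_annulus]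
    refine ⟨by simp, fun h => p.2 ?_⟩
    ext i
    fin_cases i
    · simpa using h.1
    · simpa using h.2⟩
  left_inv := by
    rintro ⟨p, hp⟩
    induction p with
    | h v hv =>
      obtain ⟨h1, -⟩ := (mk_mem_annulus hv).1 hp
      ext1
      simp only [affineCoord_mk]
      rw [Projectivization.mk_eq_mk_iff']
      refine ⟨(v 1)⁻¹, ?_⟩
      ext i
      fin_cases i <;> simp [h1, div_eq_inv_mul]
  right_inv := by
    rintro ⟨p, hp⟩
    ext i
    simp only [affineCoord_mk]
    fin_cases i <;> simp
  continuous_toFun :=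
    (continuousOn_iff_continuous_domRestrict.1 continuousOn_affineCoord).subtype_mk
      fun p => affineCoord_ne_zero p.2
  continuous_invFun := by
    refine Continuous.subtype_mk ?_ _
    refine isQuotientMap_mk'.continuous.comp (Continuous.subtype_mk ?_ _)
    refine continuous_pi fun i => ?_
    fin_cases i
    · exact (continuous_apply (0 : Fin 2)).comp (continuous_subtype_val (p := fun p => p ≠ 0))
    · exact continuous_const
    · exact (continuous_apply (1 : Fin 2)).comp (continuous_subtype_val (p := fun p => p ≠ 0))

theorem annulusHomeomorph_smul (g : GL (Fin 2) ℝ) (p : annulus) :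
    (annulusHomeomorph (g • p) : Fin 2 → ℝ) = g • (annulusHomeomorph p : Fin 2 → ℝ) := by
  obtain ⟨p, hp⟩ := p
  induction p with
  | h v hv =>
    change affineCoord (embGL g • Projectivization.mk ℝ v hv) =
      g • affineCoord (Projectivization.mk ℝ v hv)
    rw [Projectivization.smul_mk, affineCoord_mk, affineCoord_mk, embGL_smul]
    ext i
    rw [gl_smul_apply]
    fin_cases i <;> simp <;> ring

open Classical in
theorem continuousAt_ofSubtype (f : {p : Fin 2 → ℝ // p ≠ 0} ≃ₜ {p : Fin 2 → ℝ // p ≠ 0})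
    {p : Fin 2 → ℝ} (hp : p ≠ 0) : ContinuousAt (Equiv.Perm.ofSubtype f.toEquiv) p := by
  have ho : IsOpen {p : Fin 2 → ℝ | p ≠ 0} := isOpen_ne
  refine ContinuousOn.continuousAt (s := {p | p ≠ 0}) ?_ (ho.mem_nhds hp)
  rw [continuousOn_iff_continuous_domRestrict]
  refine (continuous_subtype_val.comp f.continuous).congr fun q => ?_
  exact (Equiv.Perm.ofSubtype_apply_coe f.toEquiv q).symm

open Classical in
-- Transport through `annulusHomeomorph`; `Equiv.Perm.ofSubtype` supplies the value `0` at the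
-- origin.
theorem ConjugateActions.nonempty_planeConj (h : ConjugateActions l₁ l₂) :
    Nonempty (PlaneConj l₁ l₂) := by
  obtain ⟨f, hf⟩ := h
  let φ := (annulusHomeomorph.symm.trans f).trans annulusHomeomorph
  have h0 : Equiv.Perm.ofSubtype φ.toEquiv 0 = 0 :=
    Equiv.Perm.ofSubtype_apply_of_not_mem _ (by simp)
  refine ⟨⟨Equiv.Perm.ofSubtype φ.toEquiv, h0, fun p hp => continuousAt_ofSubtype φ hp,
    fun p hp => ?_, fun γ p => ?_⟩⟩
  · have : (Equiv.Perm.ofSubtype φ.toEquiv).symm = Equiv.Perm.ofSubtype φ.symm.toEquiv :=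
      (map_inv Equiv.Perm.ofSubtype φ.toEquiv).symm
    rw [this]
    exact continuousAt_ofSubtype φ.symm hp
  · by_cases hp : p = 0
    · rw [hp, smul_zero, h0, smul_zero]
    · have hp' : l₁ γ • p ≠ 0 := (smul_ne_zero_iff_ne _).2 hp
      rw [Equiv.Perm.ofSubtype_apply_of_mem (p := fun p : Fin 2 → ℝ => p ≠ 0) _ hp,
        Equiv.Perm.ofSubtype_apply_of_mem (p := fun p : Fin 2 → ℝ => p ≠ 0) _ hp']
      change (annulusHomeomorph (f (annulusHomeomorph.symm _)) : Fin 2 → ℝ) =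
        l₂ γ • (annulusHomeomorph (f (annulusHomeomorph.symm _)) : Fin 2 → ℝ)
      rw [← annulusHomeomorph_smul, ← hf]
      congr 3
      rw [Homeomorph.symm_apply_eq]
      ext1
      rw [annulusHomeomorph_smul, Homeomorph.apply_symm_apply]

theorem continuous_smul_annulus (g : GL (Fin 2) ℝ) : Continuous fun p : annulus => g • p := by
  have hc : Continuous fun p : ℙ ℝ V => embGL g • p := by
    rw [isQuotientMap_mk'.continuous_iff]
    have hv : Continuous fun v : {v : V // v ≠ 0} => embGL g • v.1 := by
      simp only [embGL_smul]
      refine continuous_pi fun i => ?_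
      have h0 := continuous_coord 0
      have h2 := continuous_coord 2
      fin_cases i
      · exact (h0.const_mul _).add (h2.const_mul _)
      · exact continuous_coord 1
      · exact (h0.const_mul _).add (h2.const_mul _)
    exact isQuotientMap_mk'.continuous.comp
      (hv.subtype_mk fun v => (smul_ne_zero_iff_ne _).2 v.2)
  exact (hc.comp continuous_subtype_val).subtype_mk _

theorem ConjugateReps.conjugateActions (h : ConjugateReps l₁ l₂) : ConjugateActions l₁ l₂ := by
  obtain ⟨g, hg⟩ := h
  refine ⟨⟨MulAction.toPerm g, continuous_smul_annulus g, continuous_smul_annulus g⁻¹⟩, ?_⟩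
  intro γ p
  change g • l₁ γ • p = l₂ γ • g • p
  rw [hg, smul_smul, smul_smul, inv_mul_cancel_right]

end Annulus

end

end SurfaceRigidity

theorem mainTheorem11 {Γ : Type*} [Group Γ] (hΓ : SurfaceRigidity.IsSurfaceGroup Γ)
    (l₁ l₂ : Γ →* GL (Fin 2) ℝ)
    (h₁ : SurfaceRigidity.IsDiscreteFaithful l₁) (h₂ : SurfaceRigidity.IsDiscreteFaithful l₂) :
    SurfaceRigidity.ConjugateActions l₁ l₂ ↔ SurfaceRigidity.ConjugateReps l₁ l₂ := by
  refine ⟨fun h => ?_, fun h => h.conjugateActions⟩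
  obtain ⟨F⟩ := h.nonempty_planeConj
  exact F.conjugateReps h₁.1 hΓ.not_isSolvable
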